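/- Let $\mathbb{O}\cong\mathbb{R}^8$ be the algebra of octonions with standard basis $e_0=1,e_1,\dots,e_7$, i.e. $e_ie_j=-\delta_{ij}+\sum_k\epsilon_{ijk}e_k$ for $i,j\ge 1$, where $\epsilon$ is totally antisymmetric and equals $1$ on $(1,2,3),(1,4,5),(2,4,6),(3,4,7),(5,3,6),(6,1,7),(7,2,5)$ (and is $0$ off the permutations of these triples). Fix $p\in\{0,1,\dots,6\}$, put $q=7-p$, and split $\mathbb{O}=\mathbb{R}^{p+1}\oplus\mathbb{R}^{q}$ with $\mathbb{R}^{p+1}=\mathrm{span}(e_0,\dots,e_p)$ and $\mathbb{R}^q=\mathrm{span}(e_{p+1},\dots,e_7)$. Let $\mathbb{S}$ be the unit sphere of $\mathbb{R}^q$, and let $D_{x_p}=\sum_{i=0}^p e_i\partial_{x_i}$ and $\overline{D}_{x_p}=\partial_{x_0}-\sum_{i=1}^p e_i\partial_{x_i}$. Let $D\subseteq\mathbb{R}^{p+2}=\mathbb{R}^{p+1}\times\mathbb{R}$ be an open set that is invariant under $(x_p,r)\mapsto(x_p,-r)$, and let $$\Omega=\Omega_D=\{x_p+r\omega:\ \omega\in\mathbb{S},\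 r\ge 0,\ (x_p,r)\in D\}\subseteq\mathbb{O}.$$ Assume that $\Omega$ is a $p$-symmetric domain: it is non-empty, open and connected, and if $x_p+r\omega\in\Omega$ with $x_p\in\mathbb{R}^{p+1}$, $r>0$, $\omega\in\mathbb{S}$, then $x_p+r\omega'\in\Omega$ for all $\omega'\in\mathbb{S}$. Let $\mathcal{GSM}(\Omega)$ be the set of (left) generalized partial-slice monogenic functions of type $p$: the functions $f:\Omega\to\mathbb{O}$ such that for every $\omega\in\mathbb{S}$ the restriction $f_\omega(x_p,r)=f(x_p+r\omega)$ is of class $C^1$ on the open set $\Omega_\omega=\{(x_p,r)\in\mathbb{R}^{p+2}: x_p+r\omega\in\Omega\}$ and satisfies $D_{x_p}f_\omega+\omega\,\partial_r f_\omega=0$ there. Let $\mathcal{GSR}(\Omega_D)$ be the set of generalized partial-slice regular functions of type $p$: the functions $f:\Omega_D\to\mathbb{O}$ of the form $f(x_p+r\omega)=F_1(x_p,r)+\omega F_2(x_p,r)$ (for $\omega\in\mathbb{S}$, $r\ge0$, $(x_p,r)\in D$), where $F=(F_1,F_2):D\to\mathbb{O}^2$ is of class $C^1$, $F_1$ is even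 and $F_2$ is odd in $r$ ($F$ is a stem function), and $$D_{x_p}F_1-\partial_rF_2=0,\qquad \overline{D}_{x_p}F_2+\partial_rF_1=0\qquad\text{on } D.$$ Then: (i) if $\Omega\cap\mathbb{R}^{p+1}=\emptyset$, then $\mathcal{GSM}(\Omega)\supsetneqq\mathcal{GSR}(\Omega_D)$; (ii) if $\Omega\cap\mathbb{R}^{p+1}\ne\emptyset$, then $\mathcal{GSM}(\Omega)=\mathcal{GSR}(\Omega_D)$. -/

import Mathlib

noncomputable section

namespace OctSlice

/-! ### The algebra of octonions -/

/-- The octonions, as the Euclidean space `ℝ⁸` with basis `e₀ = 1, e₁, …, e₇`;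
the multiplication is defined below. -/
abbrev Octonion : Type := EuclideanSpace ℝ (Fin 8)

/-- The seven oriented triples that define the multiplication. -/
def triples : List (Fin 8 × Fin 8 × Fin 8) :=
  [(1, 2, 3), (1, 4, 5), (2, 4, 6), (3, 4, 7), (5, 3, 6), (6, 1, 7), (7, 2, 5)]

/-- The symbol `ε i j k`: the sign of the permutation that takes one of the triples
to `(i, j, k)`, and `0` if there is none. -/
def epsilon (i j k : Fin 8) : ℤ :=
  if (i, j, k) ∈ triples ∨ (j, k, i) ∈ triples ∨ (k, i, j) ∈ triples then 1
  else if (j, i, k) ∈ triples ∨ (i, k, j) ∈ triples ∨ (k, j, i) ∈ triples then -1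
  else 0

/-- The coefficient of `e_k` in the product `e_i e_j`: `e₀` is the unit, and
`e_i e_j = -δ_{ij} + ∑ k, ε_{ijk} e_k` for `i, j ≥ 1`. -/
def structConst (i j k : Fin 8) : ℤ :=
  if i = 0 then (if j = k then 1 else 0)
  else if j = 0 then (if i = k then 1 else 0)
  else if k = 0 then (if i = j then -1 else 0)
  else epsilon i j k

/-- Octonionic multiplication (bilinear, non-commutative, non-associative). -/
instance : Mul Octonion where
  mul x y := WithLp.toLp 2 fun k => ∑ i, ∑ j, (structConst i j k : ℝ) * x i * y j

/-- Octonionic conjugation. -/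
def conj (x : Octonion) : Octonion :=
  WithLp.toLp 2 fun i => if i = 0 then x 0 else -x i

/-! ### The splitting `𝕆 = ℝ^{p+1} ⊕ ℝ^q`, `q = 7 - p` -/

/-- The space `ℝ^{p+2} = ℝ^{p+1} × ℝ` of the variables `(x_p, r)`. -/
abbrev Para (p : ℕ) : Type := EuclideanSpace ℝ (Fin (p + 1)) × ℝ

/-- The inclusion `ℝ^{p+1} → 𝕆`, `(x₀, …, x_p) ↦ x₀ + x₁ e₁ + ⋯ + x_p e_p` (for `p ≤ 6`). -/
def incl (p : ℕ) (x : EuclideanSpace ℝ (Fin (p + 1))) : Octonion :=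
  WithLp.toLp 2 fun i => if h : i.val < p + 1 then x ⟨i.val, h⟩ else 0

/-- The copy of `ℝ^{p+1}` in `𝕆`. -/
def realPart (p : ℕ) : Set Octonion := Set.range (incl p)

/-- The component `x_p ∈ ℝ^{p+1}` of `x = x_p + x_q` (for `p ≤ 6`). -/
def projP (p : ℕ) (x : Octonion) : EuclideanSpace ℝ (Fin (p + 1)) :=
  WithLp.toLp 2 fun i => if h : i.val < 8 then x ⟨i.val, h⟩ else 0

/-- The component `x_q ∈ ℝ^q` of `x = x_p + x_q`. -/
def projQ (p : ℕ) (x : Octonion) : Octonion :=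
  WithLp.toLp 2 fun i => if i.val < p + 1 then 0 else x i

/-- The unit sphere `𝕊` of `ℝ^q = span(e_{p+1}, …, e_7)`. -/
def sphereQ (p : ℕ) : Set Octonion :=
  {w | (∀ i : Fin 8, i.val ≤ p → w i = 0) ∧ ‖w‖ = 1}

/-- The point `x_p + r ω` of `𝕆`. -/
def slicePt (p : ℕ) (w : Octonion) (z : Para p) : Octonion := incl p z.1 + z.2 • w

/-- `Ω` is partially symmetric with respect to `ℝ^{p+1}`. -/
def IsPSymmetric (p : ℕ) (U : Set Octonion) : Prop :=
  ∀ (x : EuclideanSpace ℝ (Fin (p + 1))) (r : ℝ), 0 < r → ∀ w ∈ sphereQ p,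
    slicePt p w (x, r) ∈ U → ∀ w' ∈ sphereQ p, slicePt p w' (x, r) ∈ U

/-! ### Differential operators in the variables `(x_p, r)` -/

/-- The partial derivative `∂g/∂x_i`, `0 ≤ i ≤ p`. -/
def dx {p : ℕ} (i : Fin (p + 1)) (g : Para p → Octonion) (z : Para p) : Octonion :=
  fderiv ℝ g z (EuclideanSpace.single i 1, 0)

/-- The partial derivative `∂g/∂r`. -/
def dr {p : ℕ} (g : Para p → Octonion) (z : Para p) : Octonion := fderiv ℝ g z (0, 1)

/-- The unit `e_i`, `0 ≤ i ≤ p`. -/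
def unitP {p : ℕ} (i : Fin (p + 1)) : Octonion := incl p (EuclideanSpace.single i 1)

/-- The operator `D_{x_p} = ∑_{i=0}^p e_i ∂_{x_i}`. -/
def DP {p : ℕ} (g : Para p → Octonion) (z : Para p) : Octonion :=
  ∑ i : Fin (p + 1), unitP i * dx i g z

/-- The conjugate operator `∂_{x_0} - ∑_{i=1}^p e_i ∂_{x_i}`. -/
def DPbar {p : ℕ} (g : Para p → Octonion) (z : Para p) : Octonion :=
  ∑ i : Fin (p + 1), conj (unitP i) * dx i g z

/-! ### Generalized partial-slice monogenic functions -/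

/-- The slice `Ω_ω = Ω ∩ (ℝ^{p+1} ⊕ ω ℝ)`, as a subset of `ℝ^{p+2}`. -/
def sliceSet (p : ℕ) (U : Set Octonion) (w : Octonion) : Set (Para p) :=
  {z | slicePt p w z ∈ U}

open Classical in
/-- The restriction `f_ω` of `f : Ω → 𝕆` to `Ω_ω`, in the variables `(x_p, r)`
(set to `0` outside `Ω_ω`, where it is never used). -/
def sliceFun (p : ℕ) {U : Set Octonion} (f : U → Octonion) (w : Octonion) :
    Para p → Octonion :=
  fun z => if h : slicePt p w z ∈ U then f ⟨slicePt p w z, h⟩ else 0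

/-- The set `GSM(Ω)` of left generalized partial-slice monogenic functions of type `p`
on the open set `Ω`: every `f_ω` is `C¹` on `Ω_ω` and `(D_{x_p} + ω ∂_r) f_ω = 0` there. -/
def GSM (p : ℕ) (U : Set Octonion) : Set (U → Octonion) :=
  {f | ∀ w ∈ sphereQ p, ContDiffOn ℝ 1 (sliceFun p f w) (sliceSet p U w) ∧
    ∀ z ∈ sliceSet p U w, DP (sliceFun p f w) z + w * dr (sliceFun p f w) z = 0}

/-! ### Generalized partial-slice regular functions -/

/-- `D` is invariant under the reflection of the last variable. -/
def IsReflInvariant {p : ℕ} (D : Set (Para p)) : Prop :=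
  ∀ (x : EuclideanSpace ℝ (Fin (p + 1))) (r : ℝ), (x, r) ∈ D → (x, -r) ∈ D

/-- The `p`-symmetric completion `Ω_D` of `D`. -/
def completion (p : ℕ) (D : Set (Para p)) : Set Octonion :=
  {y | ∃ w ∈ sphereQ p, ∃ (x : EuclideanSpace ℝ (Fin (p + 1))) (r : ℝ),
    0 ≤ r ∧ (x, r) ∈ D ∧ y = slicePt p w (x, r)}

/-- `F = (F₁, F₂)` is a stem function on `D`: on `D`, `F₁` is even and `F₂` is odd in `r`. -/
def IsStem {p : ℕ} (D : Set (Para p)) (F : Para p → Octonion × Octonion) : Prop :=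
  ∀ (x : EuclideanSpace ℝ (Fin (p + 1))) (r : ℝ), (x, r) ∈ D →
    (F (x, -r)).1 = (F (x, r)).1 ∧ (F (x, -r)).2 = -(F (x, r)).2

/-- The function `I(F)(x) = F₁(x_p, r) + ω F₂(x_p, r)`, where `r = |x_q|` and `ω = x_q / |x_q|`,
on `Ω_D`. If `x_q = 0`, then `F₂(x_p, 0) = 0` for a stem function, so that every `ω` gives the
same value, and so does the junk value `ω = 0` used here (see `induced_slicePt`). -/
def induced (p : ℕ) (D : Set (Para p)) (F : Para p → Octonion × Octonion) :
    completion p D → Octonion :=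
  fun y => (F (projP p y, ‖projQ p y‖)).1 +
    (‖projQ p (y : Octonion)‖⁻¹ • projQ p (y : Octonion)) * (F (projP p y, ‖projQ p y‖)).2

/-- The set `GSR(Ω_D)` of generalized partial-slice regular functions of type `p`: the functions
induced by a `C¹` stem function that satisfies the generalized Cauchy–Riemann equations
`D_{x_p} F₁ - ∂_r F₂ = 0`, `conj(D_{x_p}) F₂ + ∂_r F₁ = 0` on `D`. -/
def GSR (p : ℕ) (D : Set (Para p)) : Set (completion p D → Octonion) :=
  {f | ∃ F : Para p → Octonion × Octonion, IsStem D F ∧ ContDiffOn ℝ 1 F D ∧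
    (∀ z ∈ D, DP (fun u => (F u).1) z - dr (fun u => (F u).2) z = 0 ∧
      DPbar (fun u => (F u).2) z + dr (fun u => (F u).1) z = 0) ∧
    f = induced p D F}

/-! ### `I(F)` is given by `F₁ + ω F₂` for every representation `x = x_p + r ω` -/

theorem mul_apply (x y : Octonion) (k : Fin 8) :
    (x * y) k = ∑ i, ∑ j, (structConst i j k : ℝ) * x i * y j := rfl

theorem projP_slicePt {p : ℕ} (hp : p ≤ 6) {w : Octonion} (hw : w ∈ sphereQ p) (z : Para p) :
    projP p (slicePt p w z) = z.1 := by
  ext i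
  have hi : i.val < 8 := by omega
  have h0 : w ⟨i.val, hi⟩ = 0 := hw.1 _ (by simp; omega)
  have hi2 : i.val ≤ p := by omega
  simp [projP, slicePt, incl, hi, hi2, h0]

theorem projQ_slicePt {p : ℕ} {w : Octonion} (hw : w ∈ sphereQ p) (z : Para p) :
    projQ p (slicePt p w z) = z.2 • w := by
  ext i
  by_cases h : i.val < p + 1
  · have h0 : w i = 0 := hw.1 i (by omega)
    have h1 : i.val ≤ p := by omega
    simp [projQ, h1, h0]
  · have h1 : ¬ i.val ≤ p := by omega
    simp [projQ, slicePt, incl, h1]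

theorem induced_slicePt {p : ℕ} (hp : p ≤ 6) {D : Set (Para p)}
    {F : Para p → Octonion × Octonion} (hF : IsStem D F) {w : Octonion} (hw : w ∈ sphereQ p)
    {x : EuclideanSpace ℝ (Fin (p + 1))} {r : ℝ} (hr : 0 ≤ r) (hz : (x, r) ∈ D)
    (hy : slicePt p w (x, r) ∈ completion p D) :
    induced p D F ⟨slicePt p w (x, r), hy⟩ = (F (x, r)).1 + w * (F (x, r)).2 := by
  have hn : ‖r • w‖ = r := by rw [norm_smul, hw.2, mul_one, Real.norm_of_nonneg hr]
  simp only [induced, projP_slicePt hp hw, projQ_slicePt hw, hn]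
  rcases hr.eq_or_lt with rfl | hr
  · have h2 : (F (x, 0)).2 = 0 := by
      have := (hF x 0 hz).2
      rw [neg_zero] at this
      ext k
      have hk := congrArg (fun v : Octonion => v k) this
      simp only [PiLp.neg_apply] at hk
      simp only [PiLp.zero_apply]
      linarith
    have h3 : ∀ a : Octonion, a * (0 : Octonion) = 0 := by
      intro a; ext k; simp [mul_apply]
    rw [h2, h3, h3]
  · rw [smul_smul, inv_mul_cancel₀ hr.ne', one_smul]

end OctSlice

end

/-!
The Clifford identity `x̄ (y a) + ȳ (x a) = 2 ⟪x, y⟫ a` of the octonions gives, for `ω ∈ 𝕊`,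
`(D_{x_p} + ω ∂_r) (F₁ + ω F₂) = (D_{x_p} F₁ - ∂_r F₂) + ω (D̄_{x_p} F₂ + ∂_r F₁)`, hence
`GSR ⊆ GSM`.

If `Ω` misses `ℝ^{p+1}`, then `p < 6`, since for `p = 6` a connected `Ω` meets the hyperplane `ℝ^7`.
Every slice is then disconnected along `r = 0`, and the indicator function of a half-slice
`{x_p + r v : r > 0}` is monogenic on each slice. It is not in `GSR`, because it vanishes on some
slice `±u` with `u ≠ ±v`, which determines the stem function.

If `Ω` meets `ℝ^{p+1}`, the even and odd parts of `f` on one slice form a stem function `(F₁, F₂)`.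
On any other slice, `f_ω - (F₁ + ω F₂)` solves the slice equation and vanishes for `r = 0`, so an
identity theorem for such solutions is needed. The Clifford relations make the average of a
solution against a radial kernel on a ball independent of the radius, which yields a mean value
property and then real analyticity, although solutions are only assumed `C¹`. A solution that
vanishes on a hyperplane has vanishing derivative there, so that setting it to `0` on one side
gives another solution; by analyticity the latter is `0`, and hence so is the former.
-/

open MeasureTheory Metric Set Filter
open scoped Topology InnerProductSpace ContDiff Nat

section RadialKernel

variable {V : Type*} [NormedAddCommGroup V]

/-- A smooth bump on the line, equal to `1` near `0` and supported in `[-1, 1]`. The radial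
averaging kernel is built from its values at `‖z‖ ^ 2`. -/
noncomputable def radialProfile : ContDiffBump (0 : ℝ) := ⟨1 / 2, 1, by norm_num, by norm_num⟩

theorem radialProfile_eq_zero {s : ℝ} (hs : 1 ≤ s) : radialProfile s = 0 :=
  radialProfile.zero_of_le_dist (by simpa [radialProfile] using hs.trans (le_abs_self s))

theorem tsupport_comp_norm_sq_subset {g : ℝ → ℝ} (hg : ∀ s, 1 ≤ s → g s = 0) :
    tsupport (fun z : V => g (‖z‖ ^ 2)) ⊆ closedBall 0 1 := by
  refine closure_minimal (fun z hz => ?_) isClosed_closedBall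
  rw [mem_closedBall_zero_iff]
  by_contra! h
  exact hz (hg _ (by nlinarith))

theorem hasCompactSupport_of_tsupport_subset_closedBall [ProperSpace V] {g : V → ℝ} {r : ℝ}
    (hg : tsupport g ⊆ closedBall 0 r) : HasCompactSupport g :=
  (isCompact_closedBall 0 r).of_isClosed_subset (isClosed_tsupport g) hg

variable [InnerProductSpace ℝ V] [FiniteDimensional ℝ V] [MeasurableSpace V] [BorelSpace V]

/-- The radial averaging kernel of total mass `1` on the unit ball. Radiality enters through the
fact that `radialKernel z • z` is the gradient of a test function. -/
noncomputable def radialKernel (z : V) : ℝ :=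
  (∫ w : V, radialProfile (‖w‖ ^ 2))⁻¹ * radialProfile (‖z‖ ^ 2)

theorem contDiff_radialKernel : ContDiff ℝ ∞ (radialKernel : V → ℝ) :=
  contDiff_const.mul (radialProfile.contDiff.comp (contDiff_norm_sq ℝ))

theorem tsupport_radialKernel_subset : tsupport (radialKernel : V → ℝ) ⊆ closedBall 0 1 :=
  tsupport_comp_norm_sq_subset
    (g := fun s => (∫ w : V, radialProfile (‖w‖ ^ 2))⁻¹ * radialProfile s)
    fun s hs => by rw [radialProfile_eq_zero hs, mul_zero]

theorem hasCompactSupport_radialKernel : HasCompactSupport (radialKernel : V → ℝ) :=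
  hasCompactSupport_of_tsupport_subset_closedBall tsupport_radialKernel_subset

theorem integral_radialProfile_norm_sq_pos : 0 < ∫ z : V, radialProfile (‖z‖ ^ 2) := by
  refine Continuous.integral_pos_of_hasCompactSupport_nonneg_nonzero (x := 0)
    (radialProfile.continuous.comp (by fun_prop))
    (hasCompactSupport_of_tsupport_subset_closedBall
      (tsupport_comp_norm_sq_subset fun _ => radialProfile_eq_zero))
    (fun z => radialProfile.nonneg) ?_
  exact (radialProfile.one_of_mem_closedBall (by simp [radialProfile])).trans_ne one_ne_zero

theorem integral_radialKernel : ∫ z : V, radialKernel z = 1 := by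
  simp_rw [radialKernel, integral_const_mul]
  exact inv_mul_cancel₀ integral_radialProfile_norm_sq_pos.ne'

theorem exists_fderiv_eq_radialKernel_mul_inner : ∃ Φ : V → ℝ, ContDiff ℝ 2 Φ ∧
    tsupport Φ ⊆ closedBall 0 1 ∧ ∀ z v, fderiv ℝ Φ z v = radialKernel z * ⟪z, v⟫_ℝ := by
  let H : ℝ → ℝ := fun s => ∫ x in (1 : ℝ)..s, radialProfile x
  have hasDerivAt_H : ∀ s, HasDerivAt H (radialProfile s) s := fun s =>
    intervalIntegral.integral_hasDerivAt_right (radialProfile.continuous.intervalIntegrable _ _)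
      (radialProfile.continuous.stronglyMeasurableAtFilter _ _)
      radialProfile.continuous.continuousAt
  have H_eq_zero : ∀ s, 1 ≤ s → H s = 0 := fun s hs => by
    refine intervalIntegral.integral_zero_ae
      (Eventually.of_forall fun x hx => radialProfile_eq_zero ?_)
    rw [uIoc_of_le hs] at hx
    exact hx.1.le
  have contDiff_H : ContDiff ℝ 2 H := by
    rw [show (2 : WithTop ℕ∞) = 1 + 1 by norm_num, contDiff_succ_iff_deriv]
    refine ⟨fun s => (hasDerivAt_H s).differentiableAt, by simp, ?_⟩
    rw [show deriv H = radialProfile from funext fun s => (hasDerivAt_H s).deriv]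
    exact radialProfile.contDiff
  set c := ∫ w : V, radialProfile (‖w‖ ^ 2) with hc
  refine ⟨fun z => (2 * c)⁻¹ * H (‖z‖ ^ 2), contDiff_const.mul (contDiff_H.comp
    (contDiff_norm_sq ℝ)), tsupport_comp_norm_sq_subset (g := fun s => (2 * c)⁻¹ * H s)
    fun s hs => by rw [H_eq_zero s hs, mul_zero], fun z v => ?_⟩
  have hΦ : HasFDerivAt (fun z : V => (2 * c)⁻¹ * H (‖z‖ ^ 2)) _ z :=
    ((hasDerivAt_H _).comp_hasFDerivAt z (hasStrictFDerivAt_norm_sq z).hasFDerivAt).const_mul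
      (2 * c)⁻¹
  rw [hΦ.fderiv, radialKernel, ← hc]
  simp only [mul_inv_rev, smul_apply, coe_innerSL_apply, nsmul_eq_mul, Nat.cast_ofNat,
    smul_eq_mul]
  field_simp

end RadialKernel

section Translates

variable {V E : Type*} [NormedAddCommGroup V] [NormedSpace ℝ V] [NormedAddCommGroup E]
  [NormedSpace ℝ E]

theorem fderiv_comp_add_smul (g : V → E) (y z : V) (t : ℝ) :
    fderiv ℝ (fun z => g (y + t • z)) z = t • fderiv ℝ g (y + t • z) := by
  rw [← fderiv_comp_add_left, fderiv_comp_smul (f := fun z => g (y + z))]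

theorem add_smul_mem_closedBall {y z : V} {r : ℝ} (hr : 0 ≤ r)
    (hz : z ∈ closedBall (0 : V) 1) :
    y + r • z ∈ closedBall y r := by
  rw [mem_closedBall_zero_iff] at hz
  rw [mem_closedBall, dist_self_add_left, norm_smul, Real.norm_of_nonneg hr]
  exact mul_le_of_le_one_right hr hz

theorem exists_contDiff_eqOn_ball [FiniteDimensional ℝ V] {n : ℕ∞} {U : Set V} (hU : IsOpen U)
    {h : V → E} (hh : ContDiffOn ℝ n h U) {y : V} {r : ℝ} (hr : 0 < r) (hrU : closedBall y r ⊆ U) :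
    ∃ g : V → E, ContDiff ℝ n g ∧ HasCompactSupport g ∧
      ∃ s > r, ball y s ⊆ U ∧ EqOn g h (ball y s) := by
  obtain ⟨δ, hδ, hδU⟩ := (isCompact_closedBall y r).exists_cthickening_subset_open hU hrU
  rw [cthickening_closedBall hδ.le hr.le] at hδU
  let χ : ContDiffBump y := ⟨δ / 2 + r, δ + r, by positivity, by linarith⟩
  refine ⟨fun z => χ z • h z, contDiff_iff_contDiffAt.2 fun z => ?_,
    χ.hasCompactSupport.smul_right, δ / 2 + r, by linarith,
    (ball_subset_closedBall.trans (closedBall_subset_closedBall (by linarith))).trans hδU,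
    fun z hz => ?_⟩
  · by_cases hz : z ∈ tsupport fun z => χ z • h z
    · have hzU : z ∈ U := hδU (χ.tsupport_eq ▸ tsupport_smul_subset_left χ h hz)
      exact χ.contDiffAt.smul (hh.contDiffAt (hU.mem_nhds hzU))
    · exact contDiffAt_const.congr_of_eventuallyEq (notMem_tsupport_iff_eventuallyEq.1 hz)
  · simp only [χ.one_of_mem_closedBall (ball_subset_closedBall hz), one_smul]

theorem integral_smul_comp_add_smul_congr [MeasurableSpace V] {μ : Measure V} {ρ : V → ℝ}
    (hρ : tsupport ρ ⊆ closedBall 0 1) {g h : V → E} {y : V} {r : ℝ} (hr : 0 ≤ r)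
    (hg : EqOn g h (closedBall y r)) :
    ∫ z, ρ z • g (y + r • z) ∂μ = ∫ z, ρ z • h (y + r • z) ∂μ := by
  congr 1 with z
  by_cases hz : z ∈ tsupport ρ
  · rw [hg (add_smul_mem_closedBall hr (hρ hz))]
  · rw [image_eq_zero_of_notMem_tsupport hz, zero_smul, zero_smul]

end Translates

section Averages

variable {V E H : Type*} [NormedAddCommGroup V] [NormedSpace ℝ V] [FiniteDimensional ℝ V]
  [MeasurableSpace V] [BorelSpace V] {μ : Measure V} [NormedAddCommGroup E] [NormedSpace ℝ E]
  [NormedAddCommGroup H] [NormedSpace ℝ H]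

theorem hasFDerivAt_integral_smul_comp_add [IsFiniteMeasureOnCompacts μ] {ρ : V → ℝ}
    (hρ : Continuous ρ) (hρs : HasCompactSupport ρ) {g : V → E} (hg : ContDiff ℝ 1 g)
    (hgs : HasCompactSupport g) {a : V → V} (ha : Continuous a) {T : V → H →L[ℝ] V}
    (hT : Continuous T) (p : H) :
    HasFDerivAt (fun q => ∫ z, ρ z • g (a z + T z q) ∂μ)
      (∫ z, ρ z • (fderiv ℝ g (a z + T z p)).comp (T z) ∂μ) p := by
  have hg' : Continuous (fderiv ℝ g) := hg.continuous_fderiv one_ne_zero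
  obtain ⟨K, hK⟩ := hg'.bounded_above_of_compact_support (hgs.fderiv ℝ)
  have hF : ∀ q, Continuous fun z => ρ z • g (a z + T z q) := fun q =>
    hρ.smul (hg.continuous.comp (ha.add (hT.clm_apply continuous_const)))
  have hF' : Continuous fun z => ρ z • (fderiv ℝ g (a z + T z p)).comp (T z) :=
    hρ.smul ((hg'.comp (ha.add (hT.clm_apply continuous_const))).clm_comp hT)
  refine hasFDerivAt_integral_of_dominated_of_fderiv_le
    (F' := fun q z => ρ z • (fderiv ℝ g (a z + T z q)).comp (T z))
    (bound := fun z => ‖ρ z‖ * (K * ‖T z‖)) univ_mem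
    (Eventually.of_forall fun q => (hF q).aestronglyMeasurable)
    ((hF p).integrable_of_hasCompactSupport hρs.smul_right) hF'.aestronglyMeasurable
    (Eventually.of_forall fun z q _ => ?_) ?_ (Eventually.of_forall fun z q _ => ?_)
  · rw [norm_smul]
    gcongr
    exact (ContinuousLinearMap.opNorm_comp_le _ _).trans (by gcongr; exact hK _)
  · exact Continuous.integrable_of_hasCompactSupport (by fun_prop) hρs.norm.mul_right
  · exact (((hg.differentiable one_ne_zero) _).hasFDerivAt.comp q
      ((T z).hasFDerivAt.const_add (a z))).const_smul (ρ z)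

theorem contDiff_integral_smul_comp_add_smul [μ.IsAddHaarMeasure] {n : ℕ∞} {ρ : V → ℝ}
    (hρ : ContDiff ℝ n ρ) (hρs : HasCompactSupport ρ) {h : V → E} (hh : Continuous h) {t : ℝ}
    (ht : t ≠ 0) : ContDiff ℝ n fun x => ∫ z, ρ z • h (x + t • z) ∂μ := by
  let σ : V → ℝ := fun w => ρ (-(t⁻¹ • w))
  have hσ : ContDiff ℝ n (convolution σ h (ContinuousLinearMap.lsmul ℝ ℝ) μ) := by
    refine HasCompactSupport.contDiff_convolution_left _ ?_ (hρ.comp (by fun_prop))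
      hh.locallyIntegrable
    simpa only [σ, ← neg_smul] using hρs.comp_smul (neg_ne_zero.2 (inv_ne_zero ht))
  have heq : (fun x => ∫ z, ρ z • h (x + t • z) ∂μ) = fun x =>
      |t ^ Module.finrank ℝ V|⁻¹ • convolution σ h (ContinuousLinearMap.lsmul ℝ ℝ) μ x := by
    ext x
    have hscale := μ.integral_comp_inv_smul (fun z => ρ z • h (x + t • z)) t
    rw [convolution_def, eq_inv_smul_iff₀ (abs_pos.2 (pow_ne_zero _ ht)).ne', ← hscale,
      ← integral_neg_eq_self]
    simp [σ, smul_smul, ht, sub_eq_add_neg]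
  rw [heq]
  exact contDiff_const.smul hσ

theorem integral_smul_fderiv_comp_add_smul [μ.IsAddHaarMeasure] {ρ : V → ℝ} (hρ : ContDiff ℝ 1 ρ)
    (hρs : HasCompactSupport ρ) {g : V → E} (hg : ContDiff ℝ 1 g) (y v : V) (t : ℝ) :
    t • ∫ z, ρ z • fderiv ℝ g (y + t • z) v ∂μ = -∫ z, fderiv ℝ ρ z v • g (y + t • z) ∂μ := by
  have hu : ContDiff ℝ 1 fun z => g (y + t • z) := hg.comp (by fun_prop)
  rw [← integral_smul, ← integral_smul_fderiv_eq_neg_fderiv_smul_of_integrable]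
  · simp only [fderiv_comp_add_smul, smul_apply, smul_comm t]
  · exact (((hρ.continuous_fderiv one_ne_zero).clm_apply continuous_const).smul
      hu.continuous).integrable_of_hasCompactSupport (hρs.fderiv_apply ℝ v).smul_right
  · exact (hρ.continuous.smul ((hu.continuous_fderiv one_ne_zero).clm_apply
      continuous_const)).integrable_of_hasCompactSupport hρs.smul_right
  · exact (hρ.continuous.smul hu.continuous).integrable_of_hasCompactSupport hρs.smul_right
  · exact fun x _ => hρ.differentiable one_ne_zero x
  · exact fun x _ => hu.differentiable one_ne_zero x

theorem hasDerivAt_integral_smul_comp_add_smul [IsFiniteMeasureOnCompacts μ] {ρ : V → ℝ}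
    (hρ : Continuous ρ) (hρs : HasCompactSupport ρ) {g : V → E} (hg : ContDiff ℝ 1 g)
    (hgs : HasCompactSupport g) (y : V) (t : ℝ) :
    HasDerivAt (fun t => ∫ z, ρ z • g (y + t • z) ∂μ)
      (∫ z, ρ z • fderiv ℝ g (y + t • z) z ∂μ) t := by
  have hray : Continuous fun z : V => ContinuousLinearMap.toSpanSingleton ℝ z :=
    (ContinuousLinearMap.toSpanSingletonLE ℝ ℝ V).toLinearMap.continuous_of_finiteDimensional
  have hint : Integrable (fun z => ρ z • (fderiv ℝ g (y + t • z)).comp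
      (ContinuousLinearMap.toSpanSingleton ℝ z)) μ :=
    Continuous.integrable_of_hasCompactSupport (hρ.smul (((hg.continuous_fderiv one_ne_zero).comp
      (by fun_prop)).clm_comp hray)) hρs.smul_right
  have haverage := (hasFDerivAt_integral_smul_comp_add (μ := μ) hρ hρs hg hgs
    (a := fun _ => y) continuous_const hray t).hasDerivAt
  simp only [ContinuousLinearMap.toSpanSingleton_apply] at haverage
  rw [ContinuousLinearMap.integral_apply hint] at haverage
  simpa only [smul_apply, ContinuousLinearMap.comp_apply,
    ContinuousLinearMap.toSpanSingleton_apply, one_smul] using haverage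

end Averages

section Analyticity

variable {V E : Type*} [NormedAddCommGroup V] [NormedSpace ℝ V] [NormedAddCommGroup E]
  [NormedSpace ℝ E] {h : V → E} {y : V} {r K M : ℝ}

theorem norm_map_add_sub_sum_iteratedFDeriv_le [CompleteSpace E] (hh : ContDiffOn ℝ ∞ h (ball y r))
    (hM : ∀ k, ∀ x ∈ ball y r, ‖iteratedFDeriv ℝ k h x‖ ≤ M * K ^ k * k !) {v : V}
    (hv : ‖v‖ < r) (n : ℕ) :
    ‖h (y + v) - ∑ k ∈ Finset.range (n + 1), (k ! : ℝ)⁻¹ • iteratedFDeriv ℝ k h y fun _ => v‖ ≤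
      M * ((n + 1) * (K * ‖v‖) ^ (n + 1)) := by
  have hmem : ∀ t ∈ Icc (0 : ℝ) 1, y + t • v ∈ ball y r := fun t ht => by
    rw [mem_ball, dist_self_add_left, norm_smul, Real.norm_of_nonneg ht.1]
    exact (mul_le_of_le_one_left (norm_nonneg v) ht.2).trans_lt hv
  rw [map_add_eq_sum_add_integral_iteratedFDeriv fun t ht =>
    (hh.contDiffAt (isOpen_ball.mem_nhds (hmem t ht))).of_le (mod_cast le_top), add_sub_cancel_left,
    norm_smul, norm_inv, Real.norm_natCast]
  have hbound : ∀ t ∈ uIoc (0 : ℝ) 1,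
      ‖(1 - t) ^ n • iteratedFDeriv ℝ (n + 1) h (y + t • v) fun _ => v‖ ≤
        M * K ^ (n + 1) * (n + 1)! * ‖v‖ ^ (n + 1) := fun t ht => by
    rw [uIoc_of_le zero_le_one] at ht
    rw [norm_smul, norm_pow, Real.norm_of_nonneg (sub_nonneg.2 ht.2)]
    refine (mul_le_of_le_one_left (norm_nonneg _)
      (pow_le_one₀ (sub_nonneg.2 ht.2) (by linarith [ht.1]))).trans ?_
    refine (ContinuousMultilinearMap.le_opNorm _ _).trans ?_
    rw [Finset.prod_const, Finset.card_univ, Fintype.card_fin]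
    gcongr
    exact hM _ _ (hmem t (Ioc_subset_Icc_self ht))
  rw [inv_mul_le_iff₀ (by positivity)]
  refine (intervalIntegral.norm_integral_le_of_norm_le_const hbound).trans_eq ?_
  rw [sub_zero, abs_one, Nat.factorial_succ, mul_pow]
  push_cast
  ring

theorem analyticAt_of_norm_iteratedFDeriv_le [CompleteSpace E] (hr : 0 < r) (hK : 0 < K)
    (hh : ContDiffOn ℝ ∞ h (ball y r))
    (hM : ∀ k, ∀ x ∈ ball y r, ‖iteratedFDeriv ℝ k h x‖ ≤ M * K ^ k * k !) :
    AnalyticAt ℝ h y := by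
  let p : FormalMultilinearSeries ℝ V E := fun k => (k ! : ℝ)⁻¹ • iteratedFDeriv ℝ k h y
  have hp : ∀ k, ‖p k‖ ≤ M * K ^ k := fun k => by
    rw [norm_smul, norm_inv, Real.norm_natCast, inv_mul_le_iff₀ (by positivity), mul_comm]
    exact hM k y (mem_ball_self hr)
  let δ : NNReal := ⟨min r K⁻¹, by positivity⟩
  refine ⟨p, δ, p.le_radius_of_bound M fun k => ?_, ?_, fun {v} hv => ?_⟩
  · have hM0 : 0 ≤ M := (norm_nonneg _).trans ((hp 0).trans_eq (by simp))
    calc ‖p k‖ * (δ : ℝ) ^ k ≤ M * K ^ k * K⁻¹ ^ k := by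
          gcongr
          exacts [hp k, min_le_right _ _]
      _ = M := by rw [mul_assoc, ← mul_pow, mul_inv_cancel₀ hK.ne', one_pow, mul_one]
  · exact ENNReal.coe_pos.2 (lt_min hr (inv_pos.2 hK))
  · rw [Metric.eball_coe, mem_ball_zero_iff] at hv
    have hvr : ‖v‖ < r := hv.trans_le (min_le_left _ _)
    have hq : K * ‖v‖ < 1 := by
      simpa [hK.ne'] using (mul_lt_mul_iff_right₀ hK).2 (hv.trans_le (min_le_right _ _))
    have hq0 : 0 ≤ K * ‖v‖ := by positivity
    have hsum : Summable fun k => ‖p k fun _ => v‖ := by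
      refine .of_nonneg_of_le (fun _ => norm_nonneg _) (fun k => ?_)
        ((summable_geometric_of_lt_one hq0 hq).mul_left M)
      rw [mul_pow, ← mul_assoc]
      exact ((p k).le_opNorm _).trans (by simpa using by gcongr; exact hp k)
    rw [hasSum_iff_tendsto_nat_of_summable_norm hsum, ← tendsto_add_atTop_iff_nat 1,
      tendsto_iff_norm_sub_tendsto_zero]
    refine squeeze_zero (fun _ => norm_nonneg _) (fun n => ?_) (by
      simpa using ((tendsto_add_atTop_iff_nat 1).2
        (tendsto_self_mul_const_pow_of_lt_one hq0 hq)).const_mul M)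
    rw [norm_sub_rev]
    exact norm_map_add_sub_sum_iteratedFDeriv_le hh hM hvr n

end Analyticity

section MeanValueProperty

variable {V E : Type*} [NormedAddCommGroup V] [InnerProductSpace ℝ V] [FiniteDimensional ℝ V]
  [MeasurableSpace V] [BorelSpace V] [NormedAddCommGroup E] [NormedSpace ℝ E]
  {h : V → E} {U : Set V} {y : V} {r : ℝ}

/-- The mean value property of harmonic functions, with the average over a ball taken against
`radialKernel` rather than against the uniform measure, so that it can be differentiated. -/
def HasMeanValuePropertyOn (h : V → E) (U : Set V) : Prop :=
  ContinuousOn h U ∧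
    ∀ y r, 0 < r → closedBall y r ⊆ U → ∫ z, radialKernel z • h (y + r • z) = h y

theorem HasMeanValuePropertyOn.eventuallyEq_average {g : V → E}
    (hh : HasMeanValuePropertyOn h U) (hr : 0 < r) {s : ℝ} (hs : r < s) (hsU : ball y s ⊆ U)
    (hg : EqOn g h (ball y s)) :
    h =ᶠ[𝓝 y] fun x => ∫ z, radialKernel z • g (x + r • z) := by
  filter_upwards [ball_mem_nhds y (sub_pos.2 hs)] with x hx
  have hxs : closedBall x r ⊆ ball y s := closedBall_subset_ball' (by
    rw [mem_ball] at hx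
    linarith)
  rw [integral_smul_comp_add_smul_congr tsupport_radialKernel_subset hr.le (hg.mono hxs),
    hh.2 x r hr (hxs.trans hsU)]

theorem HasMeanValuePropertyOn.contDiffOn (hU : IsOpen U) (hh : HasMeanValuePropertyOn h U) :
    ContDiffOn ℝ ∞ h U := by
  intro y hy
  obtain ⟨ε, hε, hεU⟩ := nhds_basis_closedBall.mem_iff.1 (hU.mem_nhds hy)
  obtain ⟨g, hg, -, s, hs, hsU, hgh⟩ :=
    exists_contDiff_eqOn_ball (n := 0) hU (contDiffOn_zero.2 hh.1) hε hεU
  have haverage : ContDiff ℝ ∞ fun x => ∫ z, radialKernel z • g (x + ε • z) :=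
    contDiff_integral_smul_comp_add_smul (n := ⊤) contDiff_radialKernel
      hasCompactSupport_radialKernel hg.continuous hε.ne'
  exact (haverage.contDiffAt.congr_of_eventuallyEq
    (hh.eventuallyEq_average hε hs hsU hgh)).contDiffWithinAt

protected theorem HasMeanValuePropertyOn.fderiv (hU : IsOpen U) (hh : HasMeanValuePropertyOn h U) :
    HasMeanValuePropertyOn (fderiv ℝ h) U := by
  refine ⟨(hh.contDiffOn hU).continuousOn_fderiv_of_isOpen hU (by simp), fun y r hr hrU => ?_⟩
  obtain ⟨g, hg, hgs, s, hs, hsU, hgh⟩ :=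
    exists_contDiff_eqOn_ball (n := 1) hU ((hh.contDiffOn hU).of_le (by simp)) hr hrU
  have haverage := hasFDerivAt_integral_smul_comp_add (μ := volume)
    contDiff_radialKernel.continuous hasCompactSupport_radialKernel hg hgs
    (a := fun z => r • z) (by fun_prop) (T := fun _ => ContinuousLinearMap.id ℝ V)
    continuous_const y
  have hderiv : EqOn (fderiv ℝ g) (fderiv ℝ h) (closedBall y r) := fun x hx =>
    (hgh.eventuallyEq_of_mem (isOpen_ball.mem_nhds (closedBall_subset_ball hs hx))).fderiv_eq
  rw [← integral_smul_comp_add_smul_congr tsupport_radialKernel_subset hr.le hderiv,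
    (hh.eventuallyEq_average hr hs hsU hgh).fderiv_eq]
  simpa [add_comm] using haverage.fderiv.symm

theorem HasMeanValuePropertyOn.continuousLinearEquiv_comp {F : Type*} [NormedAddCommGroup F]
    [NormedSpace ℝ F] (hh : HasMeanValuePropertyOn h U) (L : E ≃L[ℝ] F) :
    HasMeanValuePropertyOn (L ∘ h) U := by
  refine ⟨L.continuous.comp_continuousOn hh.1, fun y r hr hrU => ?_⟩
  simp only [Function.comp_apply, ← map_smul, L.integral_comp_comm, hh.2 y r hr hrU]

protected theorem HasMeanValuePropertyOn.iteratedFDeriv (hU : IsOpen U)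
    (hh : HasMeanValuePropertyOn h U) (k : ℕ) :
    HasMeanValuePropertyOn (iteratedFDeriv ℝ k h) U := by
  induction k with
  | zero =>
    rw [iteratedFDeriv_zero_eq_comp]
    exact hh.continuousLinearEquiv_comp
      (continuousMultilinearCurryFin0 ℝ V E).symm.toContinuousLinearEquiv
  | succ k ih =>
    rw [iteratedFDeriv_succ_eq_comp_left]
    exact (ih.fderiv hU).continuousLinearEquiv_comp (continuousMultilinearCurryLeftEquiv ℝ
      (fun _ : Fin (k + 1) => V) E).symm.toContinuousLinearEquiv

theorem HasMeanValuePropertyOn.smul_fderiv_apply_eq (hU : IsOpen U)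
    (hh : HasMeanValuePropertyOn h U) (hr : 0 < r) (hrU : closedBall y r ⊆ U) (v : V) :
    r • fderiv ℝ h y v = -∫ z, fderiv ℝ radialKernel z v • h (y + r • z) := by
  obtain ⟨g, hg, -, s, hs, -, hgh⟩ :=
    exists_contDiff_eqOn_ball (n := 1) hU ((hh.contDiffOn hU).of_le (by simp)) hr hrU
  have hρ : ContDiff ℝ 1 (radialKernel : V → ℝ) := contDiff_radialKernel.of_le (by simp)
  have hderiv : EqOn (fderiv ℝ g) (fderiv ℝ h) (closedBall y r) := fun x hx =>
    (hgh.eventuallyEq_of_mem (isOpen_ball.mem_nhds (closedBall_subset_ball hs hx))).fderiv_eq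
  have hint : Integrable fun z => radialKernel z • fderiv ℝ g (y + r • z) :=
    (hρ.continuous.smul ((hg.continuous_fderiv one_ne_zero).comp
      (by fun_prop))).integrable_of_hasCompactSupport hasCompactSupport_radialKernel.smul_right
  rw [← integral_smul_comp_add_smul_congr ((tsupport_fderiv_apply_subset ℝ v).trans
      tsupport_radialKernel_subset) hr.le (hgh.mono (closedBall_subset_ball hs)),
    ← integral_smul_fderiv_comp_add_smul hρ hasCompactSupport_radialKernel hg,
    ← (hh.fderiv hU).2 y r hr hrU,
    ← integral_smul_comp_add_smul_congr tsupport_radialKernel_subset hr.le hderiv,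
    ContinuousLinearMap.integral_apply hint]
  simp only [smul_apply]

theorem norm_integral_fderiv_radialKernel_smul_le (hr : 0 ≤ r) {M : ℝ}
    (hM : ∀ x ∈ closedBall y r, ‖h x‖ ≤ M) (v : V) :
    ‖∫ z, fderiv ℝ radialKernel z v • h (y + r • z)‖ ≤
      (∫ z : V, ‖fderiv ℝ radialKernel z‖) * (M * ‖v‖) := by
  have hcont : Continuous (fderiv ℝ (radialKernel : V → ℝ)) :=
    contDiff_radialKernel.continuous_fderiv (by simp)
  have hsupp : HasCompactSupport (fderiv ℝ (radialKernel : V → ℝ)) :=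
    hasCompactSupport_radialKernel.fderiv ℝ
  have hint : Integrable (fderiv ℝ (radialKernel : V → ℝ)) :=
    hcont.integrable_of_hasCompactSupport hsupp
  rw [← integral_mul_const]
  refine norm_integral_le_of_norm_le (hint.norm.mul_const _) (Eventually.of_forall fun z => ?_)
  by_cases hz : z ∈ tsupport (radialKernel : V → ℝ)
  · rw [norm_smul, mul_comm M, ← mul_assoc]
    gcongr
    · exact ContinuousLinearMap.le_opNorm _ _
    · exact hM _ (add_smul_mem_closedBall hr (tsupport_radialKernel_subset hz))
  · rw [image_eq_zero_of_notMem_tsupport fun h => hz (tsupport_fderiv_subset ℝ h)]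
    simp only [zero_apply, zero_smul, norm_zero, zero_mul, le_refl]

theorem HasMeanValuePropertyOn.norm_fderiv_le (hU : IsOpen U) (hh : HasMeanValuePropertyOn h U)
    (hr : 0 < r) (hrU : closedBall y r ⊆ U) {M : ℝ} (hM : ∀ x ∈ closedBall y r, ‖h x‖ ≤ M) :
    ‖fderiv ℝ h y‖ ≤ (∫ z : V, ‖fderiv ℝ radialKernel z‖) / r * M := by
  have hM0 : 0 ≤ M := (norm_nonneg _).trans (hM y (mem_closedBall_self hr.le))
  refine ContinuousLinearMap.opNorm_le_bound _ (by positivity) fun v => ?_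
  rw [mul_assoc, div_mul_eq_mul_div, le_div_iff₀' hr]
  calc r * ‖fderiv ℝ h y v‖ = ‖∫ z, fderiv ℝ radialKernel z v • h (y + r • z)‖ := by
        rw [← norm_neg (∫ z, _), ← hh.smul_fderiv_apply_eq hU hr hrU, norm_smul,
          Real.norm_of_nonneg hr.le]
    _ ≤ _ := norm_integral_fderiv_radialKernel_smul_le hr.le hM v

theorem HasMeanValuePropertyOn.norm_iteratedFDeriv_le (hU : IsOpen U)
    (hh : HasMeanValuePropertyOn h U) (k : ℕ) (hr : 0 < r) {M : ℝ}
    (hrU : closedBall y (k * r) ⊆ U) (hM : ∀ x ∈ closedBall y (k * r), ‖h x‖ ≤ M) :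
    ‖iteratedFDeriv ℝ k h y‖ ≤ ((∫ z : V, ‖fderiv ℝ radialKernel z‖) / r) ^ k * M := by
  induction k generalizing y with
  | zero => simpa using hM y (by simp)
  | succ k ih =>
    have hsub : ∀ x ∈ closedBall y r, closedBall x (k * r) ⊆ closedBall y ((k + 1 : ℕ) * r) := by
      refine fun x hx => closedBall_subset_closedBall' ?_
      rw [mem_closedBall] at hx
      push_cast
      linarith
    have hr' : closedBall y r ⊆ closedBall y ((k + 1 : ℕ) * r) := by
      refine closedBall_subset_closedBall (le_mul_of_one_le_left hr.le ?_)
      simp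
    rw [← norm_fderiv_iteratedFDeriv, pow_succ', mul_assoc]
    exact (hh.iteratedFDeriv hU k).norm_fderiv_le hU hr (hr'.trans hrU) fun x hx =>
      ih ((hsub x hx).trans hrU) fun z hz => hM z (hsub x hx hz)

theorem natCast_add_one_pow_le (k : ℕ) :
    (k + 1 : ℝ) ^ k ≤ Real.exp 1 * Real.exp 1 ^ k * k ! := by
  rw [← pow_succ', Real.exp_one_pow, ← div_le_iff₀ (by positivity)]
  exact_mod_cast Real.pow_div_factorial_le_exp (k + 1) (by positivity) k

theorem HasMeanValuePropertyOn.analyticOnNhd [CompleteSpace E] (hU : IsOpen U)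
    (hh : HasMeanValuePropertyOn h U) : AnalyticOnNhd ℝ h U := by
  intro y hy
  obtain ⟨R, hR, hRU⟩ := nhds_basis_closedBall.mem_iff.1 (hU.mem_nhds hy)
  obtain ⟨M, hM⟩ := ((isCompact_closedBall y R).image_of_continuousOn
    (hh.1.mono hRU)).isBounded.exists_norm_le
  rw [forall_mem_image] at hM
  have hM0 : 0 ≤ M := (norm_nonneg _).trans (hM (mem_closedBall_self hR.le))
  let C := ∫ z : V, ‖fderiv ℝ radialKernel z‖
  have : 0 ≤ C := integral_nonneg fun _ => norm_nonneg _
  refine analyticAt_of_norm_iteratedFDeriv_le (r := R / 2) (K := C * (2 / R) * Real.exp 1 + 1)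
    (M := Real.exp 1 * M) (by positivity) (by positivity) ((hh.contDiffOn hU).mono
    ((ball_subset_closedBall.trans (closedBall_subset_closedBall (by linarith))).trans hRU))
    fun k x hx => ?_
  have hsub : closedBall x (k * (R / 2 / (k + 1))) ⊆ closedBall y R := by
    have hk : k * (R / 2 / (k + 1)) ≤ R / 2 := by
      rw [mul_div_left_comm]
      exact mul_le_of_le_one_right (by positivity)
        ((div_le_one₀ (by positivity)).2 (by linarith))
    refine closedBall_subset_closedBall' ?_
    rw [mem_ball] at hx
    linarith
  calc ‖iteratedFDeriv ℝ k h x‖ ≤ (C / (R / 2 / (k + 1))) ^ k * M :=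
        hh.norm_iteratedFDeriv_le hU k (by positivity) (hsub.trans hRU) fun z hz => hM (hsub hz)
    _ = (C * (2 / R)) ^ k * (k + 1) ^ k * M := by
        rw [← mul_pow]
        congr 2
        field_simp
    _ ≤ (C * (2 / R)) ^ k * (Real.exp 1 * Real.exp 1 ^ k * k !) * M := by
        gcongr
        exact natCast_add_one_pow_le k
    _ = Real.exp 1 * M * (C * (2 / R) * Real.exp 1) ^ k * k ! := by
        rw [mul_pow _ (Real.exp 1)]
        ring
    _ ≤ _ := by
        gcongr
        exact le_add_of_nonneg_right zero_le_one

end MeanValueProperty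

section Clifford

variable {ι V E F : Type*} [NormedAddCommGroup V] [InnerProductSpace ℝ V]
  [NormedAddCommGroup E] [NormedSpace ℝ E] [NormedAddCommGroup F] [NormedSpace ℝ F]

/-- The Clifford relations `A'ₖ Aⱼ + A'ⱼ Aₖ = 2 δⱼₖ`, under which the first order operator
`∑ j, A'ⱼ ∂ⱼ` composed with `∑ j, Aⱼ ∂ⱼ` is the Laplacian. -/
def IsCliffordPair [DecidableEq ι] (A : ι → E →L[ℝ] F) (A' : ι → F →L[ℝ] E) : Prop :=
  ∀ j k a, A' k (A j a) + A' j (A k a) = if j = k then (2 : ℝ) • a else 0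

theorem IsCliffordPair.injective [DecidableEq ι] {A : ι → E →L[ℝ] F} {A' : ι → F →L[ℝ] E}
    (hA : IsCliffordPair A A') (j : ι) : Function.Injective (A j) := by
  refine (injective_iff_map_eq_zero _).2 fun a ha => ?_
  have h2 := hA j j a
  rw [ha, map_zero, add_zero, if_pos rfl] at h2
  exact (smul_eq_zero.1 h2.symm).resolve_left two_ne_zero

variable [Fintype ι]

theorem IsCliffordPair.sum_diag_eq_zero [DecidableEq ι] {A : ι → E →L[ℝ] F}
    {A' : ι → F →L[ℝ] E} (hA : IsCliffordPair A A') {I : ι → ι → E} (hI : ∀ k j, I k j = I j k)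
    (h0 : ∀ k, ∑ j, A j (I k j) = 0) : ∑ k, I k k = 0 := by
  have hfirst : ∑ k, ∑ j, A' k (A j (I k j)) = 0 := by
    simp only [← map_sum, h0, map_zero, Finset.sum_const_zero]
  have hsecond : ∑ k, ∑ j, A' j (A k (I k j)) = 0 := by
    rw [Finset.sum_comm, ← hfirst]
    simp only [hI]
  refine (smul_eq_zero.1 (?_ : (2 : ℝ) • ∑ k, I k k = 0)).resolve_left two_ne_zero
  calc (2 : ℝ) • ∑ k, I k k = ∑ k, ∑ j, (A' k (A j (I k j)) + A' j (A k (I k j))) := by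
        simp only [hA _ _ _, Finset.smul_sum, Finset.sum_ite_eq', Finset.mem_univ, if_true]
    _ = 0 := by simp only [Finset.sum_add_distrib, hfirst, hsecond, add_zero]

/-- `h` is of class `C¹` on `U` and solves `∑ j, Aⱼ ∂ⱼ h = 0` there, where `∂ⱼ` is the derivative
in the direction of the basis vector `b j`. -/
def IsMonogenicOn (A : ι → E →L[ℝ] F) (b : OrthonormalBasis ι ℝ V) (h : V → E) (U : Set V) :
    Prop :=
  ContDiffOn ℝ 1 h U ∧ ∀ z ∈ U, ∑ j, A j (fderiv ℝ h z (b j)) = 0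

variable {A : ι → E →L[ℝ] F} {A' : ι → F →L[ℝ] E} {b : OrthonormalBasis ι ℝ V} {h : V → E}
  {U : Set V}

theorem IsMonogenicOn.fderiv_eq_zero_of_hyperplane [DecidableEq ι] (hA : IsCliffordPair A A')
    (hU : IsOpen U) (hh : IsMonogenicOn A b h U) {j₀ : ι}
    (h0 : ∀ z ∈ U, ⟪b j₀, z⟫_ℝ = 0 → h z = 0) {z : V} (hz : z ∈ U) (hz0 : ⟪b j₀, z⟫_ℝ = 0) :
    fderiv ℝ h z = 0 := by
  have hd : DifferentiableAt ℝ h z :=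
    (hh.1.contDiffAt (hU.mem_nhds hz)).differentiableAt one_ne_zero
  have htangent : ∀ j, j ≠ j₀ → fderiv ℝ h z (b j) = 0 := fun j hj => by
    have hline : (fun s : ℝ => h (z + s • b j)) =ᶠ[𝓝 0] fun _ => 0 := by
      have hmem : ∀ᶠ s : ℝ in 𝓝 0, z + s • b j ∈ U :=
        ContinuousAt.eventually_mem (by fun_prop) (by simpa using hU.mem_nhds hz)
      filter_upwards [hmem] with s hs
      refine h0 _ hs ?_
      rw [inner_add_right, inner_smul_right, hz0, b.inner_eq_zero hj.symm, mul_zero, add_zero]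
    rw [← hd.lineDeriv_eq_fderiv, lineDeriv, hline.deriv_eq, deriv_const]
  have hnormal : fderiv ℝ h z (b j₀) = 0 := by
    refine (injective_iff_map_eq_zero (A j₀)).1 (hA.injective j₀) _ ?_
    rw [← hh.2 z hz, Finset.sum_eq_single j₀ (fun j _ hj => by rw [htangent j hj, map_zero])
      (fun h => absurd (Finset.mem_univ _) h)]
  refine ContinuousLinearMap.coe_injective (b.toBasis.ext fun j => ?_)
  rw [b.coe_toBasis]
  rcases eq_or_ne j j₀ with rfl | hj
  exacts [hnormal, htangent j hj]

theorem hasFDerivAt_indicator_halfSpace {e z : V} {h' : V →L[ℝ] E} (hh : HasFDerivAt h h' z)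
    (h0 : ⟪e, z⟫_ℝ = 0 → h z = 0 ∧ h' = 0) :
    HasFDerivAt ({z | 0 < ⟪e, z⟫_ℝ}.indicator h) ({z | 0 < ⟪e, z⟫_ℝ}.indicator (fun _ => h') z)
      z := by
  rcases lt_trichotomy ⟪e, z⟫_ℝ 0 with hz | hz | hz
  · rw [indicator_of_notMem (by simpa using hz.le)]
    have hmem : ∀ᶠ w in 𝓝 z, ⟪e, w⟫_ℝ < 0 :=
      ContinuousAt.eventually_lt (by fun_prop) continuousAt_const hz
    exact (hasFDerivAt_const 0 z).congr_of_eventuallyEq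
      (hmem.mono fun w hw => indicator_of_notMem (by simpa using hw.le) _)
  · obtain ⟨hz0, rfl⟩ := h0 hz
    rw [indicator_zero, hasFDerivAt_iff_isLittleO_nhds_zero]
    rw [hasFDerivAt_iff_isLittleO_nhds_zero] at hh
    refine Asymptotics.IsBigO.trans_isLittleO (Asymptotics.isBigO_of_le _ fun w => ?_) hh
    simpa [hz0, hz, indicator_of_notMem] using norm_indicator_le_norm_self h (z + w)
  · rw [indicator_of_mem (by exact hz)]
    have hmem : ∀ᶠ w in 𝓝 z, 0 < ⟪e, w⟫_ℝ :=
      ContinuousAt.eventually_lt continuousAt_const (by fun_prop) hz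
    exact hh.congr_of_eventuallyEq (hmem.mono fun w hw => indicator_of_mem (by exact hw) _)

theorem continuousOn_indicator_halfSpace {X : Type*} [TopologicalSpace X] [Zero X] {f : V → X}
    {e : V} (hf : ContinuousOn f U) (h0 : ∀ z ∈ U, ⟪e, z⟫_ℝ = 0 → f z = 0) :
    ContinuousOn ({z | 0 < ⟪e, z⟫_ℝ}.indicator f) U := by
  classical
  rw [← piecewise_eq_indicator]
  refine ContinuousOn.piecewise (fun z hz => ?_) (hf.mono inter_subset_left) continuousOn_const
  exact h0 z hz.1 (frontier_lt_subset_eq continuous_const (by fun_prop) hz.2).symm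

theorem IsMonogenicOn.indicator_halfSpace [DecidableEq ι] (hA : IsCliffordPair A A')
    (hU : IsOpen U) (hh : IsMonogenicOn A b h U) {j₀ : ι}
    (h0 : ∀ z ∈ U, ⟪b j₀, z⟫_ℝ = 0 → h z = 0) :
    IsMonogenicOn A b ({z | 0 < ⟪b j₀, z⟫_ℝ}.indicator h) U := by
  have hderiv : ∀ z ∈ U, HasFDerivAt ({z | 0 < ⟪b j₀, z⟫_ℝ}.indicator h)
      ({z | 0 < ⟪b j₀, z⟫_ℝ}.indicator (fderiv ℝ h) z) z := fun z hz =>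
    hasFDerivAt_indicator_halfSpace
      ((hh.1.contDiffAt (hU.mem_nhds hz)).differentiableAt one_ne_zero).hasFDerivAt
      fun hz0 => ⟨h0 z hz hz0, hh.fderiv_eq_zero_of_hyperplane hA hU h0 hz hz0⟩
  refine ⟨(contDiffOn_succ_iff_fderiv_of_isOpen (n := 0) hU).2
    ⟨fun z hz => (hderiv z hz).differentiableAt.differentiableWithinAt, by simp, ?_⟩,
    fun z hz => ?_⟩
  · rw [contDiffOn_zero]
    exact (continuousOn_indicator_halfSpace (hh.1.continuousOn_fderiv_of_isOpen hU le_rfl)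
      fun z hz hz0 => hh.fderiv_eq_zero_of_hyperplane hA hU h0 hz hz0).congr
      fun z hz => (hderiv z hz).fderiv
  · rw [(hderiv z hz).fderiv]
    by_cases hmem : z ∈ {z | 0 < ⟪b j₀, z⟫_ℝ}
    · rw [indicator_of_mem hmem]
      exact hh.2 z hz
    · simp only [indicator_of_notMem hmem, zero_apply, map_zero, Finset.sum_const_zero]

variable [FiniteDimensional ℝ V] [MeasurableSpace V] [BorelSpace V]

theorem integral_fderiv_smul_fderiv_comm {Φ : V → ℝ} (hΦ : ContDiff ℝ 2 Φ)
    (hΦs : HasCompactSupport Φ) {u : V → E} (hu : ContDiff ℝ 1 u) (v w : V) :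
    ∫ z, fderiv ℝ Φ z v • fderiv ℝ u z w = ∫ z, fderiv ℝ Φ z w • fderiv ℝ u z v := by
  have hΦ1 : ContDiff ℝ 1 (fderiv ℝ Φ) := hΦ.fderiv_right (by norm_num)
  have hparts : ∀ v w : V, ∫ z, fderiv ℝ Φ z v • fderiv ℝ u z w =
      -∫ z, fderiv ℝ (fderiv ℝ Φ) z w v • u z := fun v w => by
    have hibp := integral_smul_fderiv_comp_add_smul (μ := volume) (hΦ1.clm_apply contDiff_const)
      (hΦs.fderiv_apply ℝ v) hu 0 w 1
    simpa [fderiv_clm_apply (hΦ1.differentiable one_ne_zero _) (differentiableAt_const v)]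
      using hibp
  rw [hparts v w, hparts w v]
  congr 2 with z
  rw [(hΦ.contDiffAt.isSymmSndFDerivAt (by simp)).eq]

theorem IsCliffordPair.integral_sum_fderiv_smul_fderiv_eq_zero [DecidableEq ι] [CompleteSpace E]
    [CompleteSpace F] (hA : IsCliffordPair A A') (b : OrthonormalBasis ι ℝ V) {Φ : V → ℝ}
    (hΦ : ContDiff ℝ 2 Φ) (hΦs : HasCompactSupport Φ) {u : V → E} (hu : ContDiff ℝ 1 u)
    (hu0 : ∀ z ∈ tsupport Φ, ∑ j, A j (fderiv ℝ u z (b j)) = 0) :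
    ∫ z, ∑ j, fderiv ℝ Φ z (b j) • fderiv ℝ u z (b j) = 0 := by
  have hint : ∀ v w : V, Integrable fun z => fderiv ℝ Φ z v • fderiv ℝ u z w := fun v w =>
    Continuous.integrable_of_hasCompactSupport
      (((hΦ.continuous_fderiv two_ne_zero).clm_apply continuous_const).smul
        ((hu.continuous_fderiv one_ne_zero).clm_apply continuous_const))
      ((hΦs.fderiv_apply ℝ v).smul_right)
  rw [integral_finsetSum _ fun j _ => hint _ _]
  refine hA.sum_diag_eq_zero (I := fun k j => ∫ z, fderiv ℝ Φ z (b k) • fderiv ℝ u z (b j))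
    (fun k j => integral_fderiv_smul_fderiv_comm hΦ hΦs hu _ _) fun k => ?_
  simp only [← (A _).integral_comp_comm (hint _ _)]
  rw [← integral_finsetSum _ fun j _ => (A j).integrable_comp (hint _ _)]
  refine integral_eq_zero_of_ae (Eventually.of_forall fun z => ?_)
  simp only [map_smul, ← Finset.smul_sum, Pi.zero_apply]
  by_cases hz : z ∈ tsupport Φ
  · rw [hu0 z hz, smul_zero]
  · rw [image_eq_zero_of_notMem_tsupport fun h => hz (tsupport_fderiv_subset ℝ h),
      zero_apply, zero_smul]

theorem IsCliffordPair.integral_radialKernel_smul_fderiv_apply_self_eq_zero [DecidableEq ι]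
    [CompleteSpace E] [CompleteSpace F] (hA : IsCliffordPair A A') (b : OrthonormalBasis ι ℝ V)
    {u : V → E} (hu : ContDiff ℝ 1 u)
    (hu0 : ∀ z ∈ closedBall 0 1, ∑ j, A j (fderiv ℝ u z (b j)) = 0) :
    ∫ z, radialKernel z • fderiv ℝ u z z = 0 := by
  obtain ⟨Φ, hΦ, hΦs, hgrad⟩ := exists_fderiv_eq_radialKernel_mul_inner (V := V)
  rw [← hA.integral_sum_fderiv_smul_fderiv_eq_zero b hΦ
    (hasCompactSupport_of_tsupport_subset_closedBall hΦs) hu fun z hz => hu0 z (hΦs hz)]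
  congr 1 with z
  simp only [hgrad, mul_smul, ← Finset.smul_sum, ← map_smul, ← map_sum, real_inner_comm (b _) z,
    b.sum_repr' z]

theorem IsCliffordPair.integral_radialKernel_smul_fderiv_comp_add_smul_eq_zero [DecidableEq ι]
    [CompleteSpace E] [CompleteSpace F] (hA : IsCliffordPair A A') {g : V → E}
    (hg : ContDiff ℝ 1 g) {y : V} {r : ℝ}
    (hg0 : ∀ x ∈ closedBall y r, ∑ j, A j (fderiv ℝ g x (b j)) = 0) {t : ℝ} (ht : t ∈ Icc 0 r) :
    ∫ z, radialKernel z • fderiv ℝ g (y + t • z) z = 0 := by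
  rcases ht.1.eq_or_lt with rfl | ht'
  · simp only [zero_smul, add_zero]
    simpa only [ContinuousLinearMap.fderiv] using
      hA.integral_radialKernel_smul_fderiv_apply_self_eq_zero b (fderiv ℝ g y).contDiff
        fun z _ => by simpa only [ContinuousLinearMap.fderiv] using hg0 y (mem_closedBall_self ht.2)
  · have hscaled := hA.integral_radialKernel_smul_fderiv_apply_self_eq_zero b
      (u := fun z => g (y + t • z)) (hg.comp (by fun_prop)) fun z hz => by
        simp only [fderiv_comp_add_smul, smul_apply, map_smul, ← Finset.smul_sum]
        rw [hg0 _ (closedBall_subset_closedBall ht.2 (add_smul_mem_closedBall ht.1 hz)), smul_zero]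
    simp only [fderiv_comp_add_smul, smul_apply, smul_comm _ t, integral_smul] at hscaled
    exact (smul_eq_zero.1 hscaled).resolve_left ht'.ne'

theorem IsMonogenicOn.hasMeanValuePropertyOn [DecidableEq ι] [CompleteSpace E] [CompleteSpace F]
    (hA : IsCliffordPair A A') (hU : IsOpen U) (hh : IsMonogenicOn A b h U) :
    HasMeanValuePropertyOn h U := by
  refine ⟨hh.1.continuousOn, fun y r hr hrU => ?_⟩
  obtain ⟨g, hg, hgs, s, hs, hsU, hgh⟩ := exists_contDiff_eqOn_ball (n := 1) hU hh.1 hr hrU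
  have hg0 : ∀ x ∈ closedBall y r, ∑ j, A j (fderiv ℝ g x (b j)) = 0 := fun x hx => by
    have hxs := closedBall_subset_ball hs hx
    rw [(hgh.eventuallyEq_of_mem (isOpen_ball.mem_nhds hxs)).fderiv_eq]
    exact hh.2 x (hsU hxs)
  have haverage := hasDerivAt_integral_smul_comp_add_smul (μ := volume)
    contDiff_radialKernel.continuous hasCompactSupport_radialKernel hg hgs y
  have hconst := constant_of_has_deriv_right_zero
    (fun t _ => (haverage t).continuousAt.continuousWithinAt)
    (fun t ht =>
      hA.integral_radialKernel_smul_fderiv_comp_add_smul_eq_zero hg hg0 ⟨ht.1, ht.2.le⟩ ▸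
        (haverage t).hasDerivWithinAt) r (right_mem_Icc.2 hr.le)
  rw [← integral_smul_comp_add_smul_congr tsupport_radialKernel_subset hr.le
    (hgh.mono (closedBall_subset_ball hs)), hconst]
  simp only [zero_smul, add_zero]
  rw [integral_smul_const, integral_radialKernel, one_smul, hgh (mem_ball_self (hr.trans hs))]

theorem IsMonogenicOn.eqOn_zero_of_eventuallyEq_zero [DecidableEq ι] [CompleteSpace E]
    [CompleteSpace F] (hA : IsCliffordPair A A') (hU : IsOpen U) (hUc : IsPreconnected U)
    (hh : IsMonogenicOn A b h U) {y : V} (hy : y ∈ U) (h0 : h =ᶠ[𝓝 y] 0) : EqOn h 0 U :=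
  AnalyticOnNhd.eqOn_zero_of_preconnected_of_eventuallyEq_zero
    ((hh.hasMeanValuePropertyOn hA hU).analyticOnNhd hU) hUc hy h0

theorem IsMonogenicOn.eqOn_zero_of_hyperplane [DecidableEq ι] [CompleteSpace E] [CompleteSpace F]
    (hA : IsCliffordPair A A') (hU : IsOpen U) (hUc : IsPreconnected U)
    (hh : IsMonogenicOn A b h U) {j₀ : ι} (h0 : ∀ z ∈ U, ⟪b j₀, z⟫_ℝ = 0 → h z = 0) {y : V}
    (hy : y ∈ U) (hy0 : ⟪b j₀, y⟫_ℝ = 0) : EqOn h 0 U := by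
  have hmem : ∀ᶠ s : ℝ in 𝓝 0, y + s • b j₀ ∈ U :=
    ContinuousAt.eventually_mem (by fun_prop) (by simpa using hU.mem_nhds hy)
  obtain ⟨ε, hε, hεU⟩ := nhds_basis_closedBall.eventually_iff.1 hmem
  have hinner : ∀ s : ℝ, ⟪b j₀, y + s • b j₀⟫_ℝ = s := fun s => by
    rw [inner_add_right, inner_smul_right, hy0, real_inner_self_eq_norm_sq, b.norm_eq_one]
    ring
  have hindicator : EqOn ({z | 0 < ⟪b j₀, z⟫_ℝ}.indicator h) 0 U := by
    refine (hh.indicator_halfSpace hA hU h0).eqOn_zero_of_eventuallyEq_zero hA hU hUc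
      (hεU (x := -ε) (by simp [abs_of_pos hε])) ?_
    have hneg : ∀ᶠ w in 𝓝 (y + (-ε) • b j₀), ⟪b j₀, w⟫_ℝ < 0 :=
      ContinuousAt.eventually_lt (by fun_prop) continuousAt_const
        (by rwa [hinner, neg_lt_zero])
    exact hneg.mono fun w hw => indicator_of_notMem (by simpa using hw.le) _
  have hεmem : y + ε • b j₀ ∈ U := hεU (by simp [abs_of_pos hε])
  refine hh.eqOn_zero_of_eventuallyEq_zero hA hU hUc hεmem ?_
  have hpos : ∀ᶠ w in 𝓝 (y + ε • b j₀), 0 < ⟪b j₀, w⟫_ℝ :=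
    ContinuousAt.eventually_lt continuousAt_const (by fun_prop) (by rwa [hinner])
  filter_upwards [hpos, hU.mem_nhds hεmem] with w hw hwU
  rw [← hindicator hwU, indicator_of_mem (by exact hw)]

end Clifford

namespace OctSlice

section Algebra

theorem eq_zero_of_add_eq_zero_of_sub_eq_zero {M : Type*} [AddCommGroup M] [Module ℝ M] {a b : M}
    (hadd : a + b = 0) (hsub : a - b = 0) : a = 0 ∧ b = 0 := by
  have ha : a = 0 := by
    calc a = (1 / 2 : ℝ) • ((a + b) + (a - b)) := by module
      _ = 0 := by rw [hadd, hsub, add_zero, smul_zero]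
  exact ⟨ha, by rwa [ha, zero_add] at hadd⟩

instance : NonUnitalNonAssocRing Octonion where
  left_distrib a x y := by
    ext k
    simp only [mul_apply, PiLp.add_apply, mul_add, Finset.sum_add_distrib]
  right_distrib a b x := by
    ext k
    simp only [mul_apply, PiLp.add_apply, mul_add, add_mul, Finset.sum_add_distrib]
  zero_mul a := by
    ext k
    simp [mul_apply]
  mul_zero a := by
    ext k
    simp [mul_apply]

instance : IsScalarTower ℝ Octonion Octonion where
  smul_assoc c a x := by
    ext k
    simp only [smul_eq_mul, mul_apply, PiLp.smul_apply, Finset.mul_sum]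
    exact Finset.sum_congr rfl fun i _ => Finset.sum_congr rfl fun j _ => by ring

instance : SMulCommClass ℝ Octonion Octonion where
  smul_comm c a x := by
    ext k
    simp only [smul_eq_mul, mul_apply, PiLp.smul_apply, Finset.mul_sum]
    exact Finset.sum_congr rfl fun i _ => Finset.sum_congr rfl fun j _ => by ring

/-- Left multiplication by an octonion, as a continuous linear map. -/
noncomputable def mulLeft (a : Octonion) : Octonion →L[ℝ] Octonion :=
  (LinearMap.mulLeft ℝ a).toContinuousLinearMap

@[simp]
theorem mulLeft_apply (a x : Octonion) : mulLeft a x = a * x := rfl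

theorem mul_explicit (x y : Octonion) : x * y = WithLp.toLp 2
    ![x 0 * y 0 - x 1 * y 1 - x 2 * y 2 - x 3 * y 3
        - x 4 * y 4 - x 5 * y 5 - x 6 * y 6 - x 7 * y 7,
      x 0 * y 1 + x 1 * y 0 + x 2 * y 3 - x 3 * y 2
        + x 4 * y 5 - x 5 * y 4 - x 6 * y 7 + x 7 * y 6,
      x 0 * y 2 + x 2 * y 0 + x 3 * y 1 - x 1 * y 3
        + x 4 * y 6 - x 6 * y 4 + x 5 * y 7 - x 7 * y 5,
      x 0 * y 3 + x 3 * y 0 + x 1 * y 2 - x 2 * y 1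
        + x 4 * y 7 - x 7 * y 4 - x 5 * y 6 + x 6 * y 5,
      x 0 * y 4 + x 4 * y 0 + x 5 * y 1 - x 1 * y 5
        + x 6 * y 2 - x 2 * y 6 + x 7 * y 3 - x 3 * y 7,
      x 0 * y 5 + x 5 * y 0 + x 1 * y 4 - x 4 * y 1
        + x 3 * y 6 - x 6 * y 3 - x 2 * y 7 + x 7 * y 2,
      x 0 * y 6 + x 6 * y 0 + x 2 * y 4 - x 4 * y 2
        - x 3 * y 5 + x 5 * y 3 + x 1 * y 7 - x 7 * y 1,
      x 0 * y 7 + x 7 * y 0 + x 3 * y 4 - x 4 * y 3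
        - x 1 * y 6 + x 6 * y 1 - x 5 * y 2 + x 2 * y 5] := by
  ext k
  fin_cases k <;>
  · simp [mul_apply, Fin.sum_univ_eight, structConst, epsilon, triples]
    ring

theorem conj_mul_mul_add (x y a : Octonion) :
    conj x * (y * a) + conj y * (x * a) = (2 * ⟪x, y⟫_ℝ) • a := by
  rw [mul_explicit, mul_explicit y a, mul_explicit, mul_explicit x a]
  ext k
  fin_cases k <;>
  · simp [conj, PiLp.inner_apply, Fin.sum_univ_eight]
    ring

theorem conj_conj (x : Octonion) : conj (conj x) = x := by
  ext i
  by_cases h : i = 0 <;> simp [conj, h]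

theorem inner_conj_left (x y : Octonion) : ⟪conj x, y⟫_ℝ = ⟪x, conj y⟫_ℝ := by
  simp [PiLp.inner_apply, Fin.sum_univ_eight, conj]

theorem mul_mul_of_inner_eq_zero {x w : Octonion} (hw : conj w = -w) (h : ⟪x, w⟫_ℝ = 0)
    (a : Octonion) : x * (w * a) = w * (conj x * a) := by
  have hclifford := conj_mul_mul_add (conj x) w a
  rw [conj_conj, inner_conj_left, hw, inner_neg_right, h, neg_zero, mul_zero, zero_smul,
    neg_mul] at hclifford
  exact add_neg_eq_zero.1 hclifford

theorem isCliffordPair_mulLeft {ι : Type*} [DecidableEq ι] {u : ι → Octonion}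
    (hu : Orthonormal ℝ u) :
    IsCliffordPair (fun j => mulLeft (u j)) (fun j => mulLeft (conj (u j))) := by
  intro j k a
  simp only [mulLeft_apply, conj_mul_mul_add, orthonormal_iff_ite.1 hu k j, eq_comm (a := k)]
  split_ifs <;> simp

end Algebra

section Units

variable {p : ℕ} {w : Octonion}

theorem single_mem_sphereQ {i : Fin 8} (hi : p < i.val) :
    EuclideanSpace.single i (1 : ℝ) ∈ sphereQ p := by
  refine ⟨fun j hj => ?_, by simp⟩
  have hji : j ≠ i := by
    rintro rfl
    omega
  simp [hji]

theorem neg_mem_sphereQ (hw : w ∈ sphereQ p) : -w ∈ sphereQ p :=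
  ⟨fun i hi => by simp [hw.1 i hi], by rw [norm_neg, hw.2]⟩

theorem conj_eq_neg (hw : w ∈ sphereQ p) : conj w = -w := by
  ext i
  by_cases h : i = 0
  · subst h
    simp [conj, hw.1 0 (by simp)]
  · simp [conj, h]

theorem sphereQ_mul_mul (hw : w ∈ sphereQ p) (a : Octonion) : w * (w * a) = -a := by
  have hclifford := conj_mul_mul_add w w a
  rw [conj_eq_neg hw, real_inner_self_eq_norm_sq, hw.2, neg_mul, one_pow, mul_one, ← two_smul ℝ,
    smul_neg, ← smul_neg] at hclifford
  exact neg_eq_iff_eq_neg.1 (smul_right_injective _ two_ne_zero hclifford)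

theorem eq_zero_of_sphereQ_mul_eq_zero (hw : w ∈ sphereQ p) {a : Octonion} (h : w * a = 0) :
    a = 0 := by
  rw [← neg_eq_zero, ← sphereQ_mul_mul hw, h, mul_zero]

theorem unitP_eq (hp : p ≤ 6) (i : Fin (p + 1)) :
    unitP i = EuclideanSpace.single (Fin.castLE (by omega) i : Fin 8) (1 : ℝ) := by
  ext k
  simp only [unitP, incl, PiLp.single_apply, Fin.ext_iff, Fin.val_castLE]
  split_ifs <;> first | rfl | omega

theorem inner_unitP (hp : p ≤ 6) (i : Fin (p + 1)) (x : Octonion) :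
    ⟪unitP i, x⟫_ℝ = x (Fin.castLE (by omega) i) := by
  rw [unitP_eq hp, EuclideanSpace.inner_single_left]
  simp

theorem inner_unitP_sphereQ (hp : p ≤ 6) (i : Fin (p + 1)) (hw : w ∈ sphereQ p) :
    ⟪unitP i, w⟫_ℝ = 0 := by
  rw [inner_unitP hp]
  exact hw.1 _ (Nat.lt_succ_iff.1 i.isLt)

theorem orthonormal_unitP_sphereQ (hp : p ≤ 6) (hw : w ∈ sphereQ p) :
    Orthonormal ℝ (Sum.elim unitP fun _ => w : Fin (p + 1) ⊕ Unit → Octonion) := by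
  rw [orthonormal_iff_ite]
  rintro (i | _) (j | _)
  · rw [Sum.elim_inl, Sum.elim_inl, inner_unitP hp, unitP_eq hp]
    simp [PiLp.single_apply]
  · simp [inner_unitP_sphereQ hp i hw]
  · simpa using (real_inner_comm _ _).trans (inner_unitP_sphereQ hp j hw)
  · simp [hw.2]

end Units

section SliceDirac

variable {p : ℕ} {D : Set (Para p)} {w : Octonion} {g h F₁ F₂ : Para p → Octonion} {z : Para p}

/-- The operator `D_{x_p} + ω ∂_r` of the slice determined by `ω`. -/
noncomputable def sliceDirac (w : Octonion) (g : Para p → Octonion) (z : Para p) : Octonion :=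
  DP g z + w * dr g z

/-- `g` is of class `C¹` on `D` and solves the equation `(D_{x_p} + ω ∂_r) g = 0` there, which
`GSM` requires of the restriction to the slice determined by `ω`. -/
def IsSliceMonogenicOn (w : Octonion) (g : Para p → Octonion) (D : Set (Para p)) : Prop :=
  ContDiffOn ℝ 1 g D ∧ ∀ z ∈ D, sliceDirac w g z = 0

theorem sliceDirac_congr (hgh : g =ᶠ[𝓝 z] h) : sliceDirac w g z = sliceDirac w h z := by
  simp only [sliceDirac, DP, dx, dr, hgh.fderiv_eq]

theorem sliceDirac_const (c : Octonion) : sliceDirac w (fun _ : Para p => c) z = 0 := by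
  simp [sliceDirac, DP, dx, dr]

theorem sliceDirac_sub (hg : DifferentiableAt ℝ g z) (hh : DifferentiableAt ℝ h z) :
    sliceDirac w (g - h) z = sliceDirac w g z - sliceDirac w h z := by
  simp only [sliceDirac, DP, dx, dr, fderiv_sub hg hh, sub_apply, mul_sub,
    Finset.sum_sub_distrib]
  abel

theorem sliceDirac_add_mul (hp : p ≤ 6) (hw : w ∈ sphereQ p) (h₁ : DifferentiableAt ℝ F₁ z)
    (h₂ : DifferentiableAt ℝ F₂ z) :
    sliceDirac w (fun u => F₁ u + w * F₂ u) z =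
      (DP F₁ z - dr F₂ z) + w * (DPbar F₂ z + dr F₁ z) := by
  have hderiv : HasFDerivAt (fun u => F₁ u + w * F₂ u)
      (fderiv ℝ F₁ z + (mulLeft w).comp (fderiv ℝ F₂ z)) z :=
    h₁.hasFDerivAt.add ((mulLeft w).hasFDerivAt.comp z h₂.hasFDerivAt)
  have hunit : ∀ (i : Fin (p + 1)) a, unitP i * (w * a) = w * (conj (unitP i) * a) := fun i =>
    mul_mul_of_inner_eq_zero (conj_eq_neg hw) (inner_unitP_sphereQ hp i hw)
  simp only [sliceDirac, DP, DPbar, dx, dr, hderiv.fderiv, add_apply,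
    ContinuousLinearMap.comp_apply, mulLeft_apply, mul_add, Finset.sum_add_distrib, hunit,
    ← Finset.mul_sum, sphereQ_mul_mul hw]
  abel

theorem IsSliceMonogenicOn.differentiableAt (hg : IsSliceMonogenicOn w g D) (hD : IsOpen D)
    (hz : z ∈ D) : DifferentiableAt ℝ g z :=
  (hg.1.contDiffAt (hD.mem_nhds hz)).differentiableAt one_ne_zero

theorem IsSliceMonogenicOn.congr (hg : IsSliceMonogenicOn w g D) (hD : IsOpen D)
    (hgh : EqOn h g D) : IsSliceMonogenicOn w h D :=
  ⟨hg.1.congr hgh, fun z hz => by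
    rw [sliceDirac_congr (hgh.eventuallyEq_of_mem (hD.mem_nhds hz)), hg.2 z hz]⟩

theorem IsSliceMonogenicOn.sub (hg : IsSliceMonogenicOn w g D) (hh : IsSliceMonogenicOn w h D)
    (hD : IsOpen D) : IsSliceMonogenicOn w (g - h) D :=
  ⟨hg.1.sub hh.1, fun z hz => by
    rw [sliceDirac_sub (hg.differentiableAt hD hz) (hh.differentiableAt hD hz), hg.2 z hz,
      hh.2 z hz, sub_zero]⟩

theorem isSliceMonogenicOn_add_mul (hp : p ≤ 6) (hD : IsOpen D) (hw : w ∈ sphereQ p)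
    (h₁ : ContDiffOn ℝ 1 F₁ D) (h₂ : ContDiffOn ℝ 1 F₂ D)
    (hcr : ∀ z ∈ D, DP F₁ z - dr F₂ z = 0 ∧ DPbar F₂ z + dr F₁ z = 0) :
    IsSliceMonogenicOn w (fun z => F₁ z + w * F₂ z) D := by
  refine ⟨h₁.add ((mulLeft w).contDiff.comp_contDiffOn h₂), fun z hz => ?_⟩
  rw [sliceDirac_add_mul hp hw ((h₁.contDiffAt (hD.mem_nhds hz)).differentiableAt one_ne_zero)
    ((h₂.contDiffAt (hD.mem_nhds hz)).differentiableAt one_ne_zero), (hcr z hz).1, (hcr z hz).2,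
    mul_zero, add_zero]

theorem cauchyRiemann_of_sliceDirac_eq_zero (hp : p ≤ 6) (hw : w ∈ sphereQ p)
    (h₁ : DifferentiableAt ℝ F₁ z) (h₂ : DifferentiableAt ℝ F₂ z)
    (hpos : sliceDirac w (fun u => F₁ u + w * F₂ u) z = 0)
    (hneg : sliceDirac (-w) (fun u => F₁ u + -w * F₂ u) z = 0) :
    DP F₁ z - dr F₂ z = 0 ∧ DPbar F₂ z + dr F₁ z = 0 := by
  rw [sliceDirac_add_mul hp hw h₁ h₂] at hpos
  rw [sliceDirac_add_mul hp (neg_mem_sphereQ hw) h₁ h₂, neg_mul,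
    ← sub_eq_add_neg] at hneg
  obtain ⟨hfirst, hsecond⟩ := eq_zero_of_add_eq_zero_of_sub_eq_zero hpos hneg
  exact ⟨hfirst, eq_zero_of_sphereQ_mul_eq_zero hw hsecond⟩

end SliceDirac

section IdentityTheorem

variable {p : ℕ} {D : Set (Para p)} {w : Octonion} {g h : Para p → Octonion}

/-- The standard basis of `ℝ^{p+2}`. The product `Para p` carries the supremum norm, so the
Euclidean structure lives on its `L²` version. -/
noncomputable def paraBasis (p : ℕ) :
    OrthonormalBasis (Fin (p + 1) ⊕ Unit) ℝ (WithLp 2 (EuclideanSpace ℝ (Fin (p + 1)) × ℝ)) :=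
  (EuclideanSpace.basisFun (Fin (p + 1)) ℝ).prod (OrthonormalBasis.singleton Unit ℝ)

theorem inner_paraBasis_inr (z : WithLp 2 (EuclideanSpace ℝ (Fin (p + 1)) × ℝ)) :
    ⟪paraBasis p (Sum.inr ()), z⟫_ℝ = z.snd := by
  simp [paraBasis, OrthonormalBasis.prod_apply, WithLp.prod_inner_apply]

theorem IsSliceMonogenicOn.isMonogenicOn (hg : IsSliceMonogenicOn w g D) :
    IsMonogenicOn (fun j => mulLeft (Sum.elim unitP (fun _ => w) j)) (paraBasis p)
      (g ∘ WithLp.prodContinuousLinearEquiv 2 ℝ _ ℝ)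
      (WithLp.prodContinuousLinearEquiv 2 ℝ _ ℝ ⁻¹' D) := by
  refine ⟨hg.1.comp (ContinuousLinearEquiv.contDiff _).contDiffOn (mapsTo_preimage _ D),
    fun z hz => ?_⟩
  rw [ContinuousLinearEquiv.comp_right_fderiv, Fintype.sum_sum_type]
  simpa [sliceDirac, DP, dx, dr, paraBasis, OrthonormalBasis.prod_apply] using hg.2 _ hz

theorem IsSliceMonogenicOn.eqOn_zero (hp : p ≤ 6) (hw : w ∈ sphereQ p) (hD : IsOpen D)
    (hDc : IsPreconnected D) (hg : IsSliceMonogenicOn w g D)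
    (h0 : ∀ x, (x, (0 : ℝ)) ∈ D → g (x, 0) = 0)
    {x₀ : EuclideanSpace ℝ (Fin (p + 1))} (hx₀ : (x₀, (0 : ℝ)) ∈ D) : EqOn g 0 D := by
  let e := WithLp.prodContinuousLinearEquiv 2 ℝ (EuclideanSpace ℝ (Fin (p + 1))) ℝ
  have hpre : IsPreconnected (e ⁻¹' D) := by
    rw [← e.image_symm_eq_preimage]
    exact hDc.image _ e.symm.continuous.continuousOn
  have hzero : EqOn (g ∘ e) 0 (e ⁻¹' D) := by
    refine hg.isMonogenicOn.eqOn_zero_of_hyperplane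
      (isCliffordPair_mulLeft (orthonormal_unitP_sphereQ hp hw)) (hD.preimage e.continuous) hpre
      (j₀ := Sum.inr ()) (y := e.symm (x₀, 0)) (fun z hz hz0 => ?_) (by simpa using hx₀)
      (by rw [inner_paraBasis_inr]; rfl)
    have hez : e z = ((e z).1, 0) := Prod.ext rfl ((inner_paraBasis_inr z).symm.trans hz0)
    rw [Function.comp_apply, hez]
    exact h0 _ (hez ▸ hz)
  intro z hz
  simpa using hzero (x := e.symm z) (by simpa using hz)

theorem IsSliceMonogenicOn.eqOn (hp : p ≤ 6) (hw : w ∈ sphereQ p) (hD : IsOpen D)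
    (hDc : IsPreconnected D) (hg : IsSliceMonogenicOn w g D) (hh : IsSliceMonogenicOn w h D)
    (h0 : ∀ x, (x, (0 : ℝ)) ∈ D → g (x, 0) = h (x, 0))
    {x₀ : EuclideanSpace ℝ (Fin (p + 1))} (hx₀ : (x₀, (0 : ℝ)) ∈ D) : EqOn g h D := fun _ hz =>
  sub_eq_zero.1 ((hg.sub hh hD).eqOn_zero hp hw hD hDc (fun x hx => sub_eq_zero.2 (h0 x hx))
    hx₀ hz)

end IdentityTheorem

section Reflection

variable {p : ℕ} {D : Set (Para p)} {w η : Octonion} {g : Para p → Octonion} {z : Para p}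

/-- The reflection `(x_p, r) ↦ (x_p, -r)`. -/
noncomputable def reflection (p : ℕ) : Para p ≃L[ℝ] Para p :=
  (ContinuousLinearEquiv.refl ℝ _).prodCongr (ContinuousLinearEquiv.neg ℝ)

@[simp]
theorem reflection_apply (x : EuclideanSpace ℝ (Fin (p + 1))) (r : ℝ) :
    reflection p (x, r) = (x, -r) := rfl

theorem IsReflInvariant.mapsTo_reflection (hD : IsReflInvariant D) :
    MapsTo (reflection p) D D :=
  fun _ hz => hD _ _ hz

theorem sliceDirac_neg_comp_reflection (g : Para p → Octonion) (z : Para p) :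
    sliceDirac (-w) (g ∘ reflection p) z = sliceDirac w g (reflection p z) := by
  have hneg : ((0 : EuclideanSpace ℝ (Fin (p + 1))), (-1 : ℝ)) = -(0, 1) := by simp
  simp only [sliceDirac, DP, dx, dr, ContinuousLinearEquiv.comp_right_fderiv,
    ContinuousLinearMap.comp_apply, ContinuousLinearEquiv.coe_coe, reflection_apply, neg_zero,
    hneg, map_neg, neg_mul_neg]

/-- The stem function `(F₁, F₂)` for which `F₁ + η F₂ = g`: the even part of `g` and `-η` times
its odd part. -/
noncomputable def stemOf (η : Octonion) (g : Para p → Octonion) (z : Para p) :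
    Octonion × Octonion :=
  ((1 / 2 : ℝ) • (g z + g (reflection p z)), (1 / 2 : ℝ) • (η * (g (reflection p z) - g z)))

theorem isStem_stemOf (η : Octonion) (g : Para p → Octonion) : IsStem D (stemOf η g) := by
  refine fun x r _ => ⟨?_, ?_⟩
  · simp [stemOf, add_comm]
  · simp only [stemOf, reflection_apply, neg_neg]
    rw [← smul_neg, ← mul_neg, neg_sub]

theorem stemOf_fst_add_mul_snd (hη : η ∈ sphereQ p) (g : Para p → Octonion) (z : Para p) :
    (stemOf η g z).1 + η * (stemOf η g z).2 = g z := by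
  simp only [stemOf, mul_smul_comm, sphereQ_mul_mul hη, neg_sub]
  module

theorem stemOf_fst_add_neg_mul_snd (hη : η ∈ sphereQ p) (g : Para p → Octonion) (z : Para p) :
    (stemOf η g z).1 + -η * (stemOf η g z).2 = g (reflection p z) := by
  simp only [stemOf, neg_mul, mul_smul_comm, sphereQ_mul_mul hη, neg_sub]
  module

theorem contDiffOn_stemOf (hD : IsReflInvariant D) (η : Octonion) (hg : ContDiffOn ℝ 1 g D) :
    ContDiffOn ℝ 1 (stemOf η g) D := by
  have hrefl : ContDiffOn ℝ 1 (g ∘ reflection p) D :=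
    hg.comp (reflection p).contDiff.contDiffOn hD.mapsTo_reflection
  exact ((hg.add hrefl).const_smul (1 / 2 : ℝ)).prodMk
    (((mulLeft η).contDiff.comp_contDiffOn (hrefl.sub hg)).const_smul (1 / 2 : ℝ))

theorem IsSliceMonogenicOn.cauchyRiemann_stemOf (hp : p ≤ 6) (hDo : IsOpen D)
    (hD : IsReflInvariant D) (hη : η ∈ sphereQ p) (hg : IsSliceMonogenicOn η g D) (hz : z ∈ D) :
    DP (fun u => (stemOf η g u).1) z - dr (fun u => (stemOf η g u).2) z = 0 ∧
      DPbar (fun u => (stemOf η g u).2) z + dr (fun u => (stemOf η g u).1) z = 0 := by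
  have hstem : DifferentiableAt ℝ (stemOf η g) z :=
    ((contDiffOn_stemOf hD η hg.1).contDiffAt (hDo.mem_nhds hz)).differentiableAt one_ne_zero
  refine cauchyRiemann_of_sliceDirac_eq_zero hp hη hstem.fst hstem.snd ?_ ?_
  · simpa only [stemOf_fst_add_mul_snd hη] using hg.2 z hz
  · simp only [stemOf_fst_add_neg_mul_snd hη]
    exact (sliceDirac_neg_comp_reflection g z).trans (hg.2 _ (hD.mapsTo_reflection hz))

end Reflection

section Completion

variable {p : ℕ} {D : Set (Para p)} {w : Octonion} {z : Para p}

theorem slicePt_neg (w : Octonion) (x : EuclideanSpace ℝ (Fin (p + 1))) (r : ℝ) :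
    slicePt p (-w) (x, -r) = slicePt p w (x, r) := by
  simp [slicePt]

theorem slicePt_zero (w : Octonion) (x : EuclideanSpace ℝ (Fin (p + 1))) :
    slicePt p w (x, 0) = incl p x := by
  simp [slicePt]

theorem norm_projQ_slicePt (hw : w ∈ sphereQ p) (z : Para p) :
    ‖projQ p (slicePt p w z)‖ = |z.2| := by
  rw [projQ_slicePt hw, norm_smul, hw.2, mul_one, Real.norm_eq_abs]

theorem slicePt_mem_completion (hD : IsReflInvariant D) (hw : w ∈ sphereQ p) (hz : z ∈ D) :
    slicePt p w z ∈ completion p D := by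
  rcases le_total 0 z.2 with h | h
  · exact ⟨w, hw, z.1, z.2, h, hz, rfl⟩
  · exact ⟨-w, neg_mem_sphereQ hw, z.1, -z.2, by linarith, hD _ _ hz, (slicePt_neg w _ _).symm⟩

theorem slicePt_mem_completion_iff (hp : p ≤ 6) (hD : IsReflInvariant D) (hw : w ∈ sphereQ p) :
    slicePt p w z ∈ completion p D ↔ z ∈ D := by
  refine ⟨?_, slicePt_mem_completion hD hw⟩
  rintro ⟨w', hw', x, r, hr, hz, h⟩
  have hfst : z.1 = x := by
    rw [← projP_slicePt hp hw z, h, projP_slicePt hp hw']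
  have hsnd : |z.2| = r := by
    rw [← norm_projQ_slicePt hw z, h, norm_projQ_slicePt hw', abs_of_nonneg hr]
  subst hfst hsnd
  rcases abs_choice z.2 with habs | habs
  · rwa [habs] at hz
  · rw [habs] at hz
    simpa using hD _ _ hz

theorem sliceSet_completion (hp : p ≤ 6) (hD : IsReflInvariant D) (hw : w ∈ sphereQ p) :
    sliceSet p (completion p D) w = D :=
  Set.ext fun _ => slicePt_mem_completion_iff hp hD hw

theorem completion_inter_realPart_nonempty_iff (hp : p ≤ 6) (hD : IsReflInvariant D) :
    (completion p D ∩ realPart p).Nonempty ↔ ∃ x, (x, (0 : ℝ)) ∈ D := by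
  have hη : EuclideanSpace.single 7 (1 : ℝ) ∈ sphereQ p := single_mem_sphereQ (by simp; omega)
  simp only [← slicePt_mem_completion_iff hp hD hη, slicePt_zero]
  constructor
  · rintro ⟨_, hy, x, rfl⟩
    exact ⟨x, hy⟩
  · rintro ⟨x, hx⟩
    exact ⟨_, hx, x, rfl⟩

theorem continuous_projP : Continuous (projP p) := by
  refine (PiLp.continuous_toLp 2 _).comp (continuous_pi fun i => ?_)
  split_ifs with h <;> fun_prop

theorem continuous_projQ : Continuous (projQ p) := by
  refine (PiLp.continuous_toLp 2 _).comp (continuous_pi fun i => ?_)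
  split_ifs with h <;> fun_prop

theorem image_projP_norm_projQ_completion (hp : p ≤ 6) (hD : IsReflInvariant D) :
    (fun y => (projP p y, ‖projQ p y‖)) '' completion p D = D ∩ {z | 0 ≤ z.2} := by
  have hη : EuclideanSpace.single 7 (1 : ℝ) ∈ sphereQ p := single_mem_sphereQ (by simp; omega)
  ext z
  constructor
  · rintro ⟨_, ⟨w, hw, x, r, hr, hz, rfl⟩, rfl⟩
    simp only [projP_slicePt hp hw, norm_projQ_slicePt hw, abs_of_nonneg hr]
    exact ⟨hz, hr⟩
  · rintro ⟨hz, hr⟩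
    refine ⟨_, slicePt_mem_completion hD hη hz, ?_⟩
    simp only [projP_slicePt hp hη, norm_projQ_slicePt hη]
    rw [abs_of_nonneg hr]

theorem IsReflInvariant.union_image_reflection (hD : IsReflInvariant D) :
    (D ∩ {z | 0 ≤ z.2}) ∪ reflection p '' (D ∩ {z | 0 ≤ z.2}) = D := by
  refine subset_antisymm (union_subset inter_subset_left ?_) fun ⟨x, r⟩ hz => ?_
  · rintro _ ⟨z, hz, rfl⟩
    exact hD.mapsTo_reflection hz.1
  · rcases le_total 0 r with hr | hr
    · exact Or.inl ⟨hz, hr⟩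
    · exact Or.inr ⟨(x, -r), ⟨hD _ _ hz, neg_nonneg.2 hr⟩, by simp⟩

theorem isPreconnected_of_completion (hp : p ≤ 6) (hD : IsReflInvariant D)
    (hc : IsPreconnected (completion p D)) {x : EuclideanSpace ℝ (Fin (p + 1))}
    (hx : (x, (0 : ℝ)) ∈ D) : IsPreconnected D := by
  have hnonneg : IsPreconnected (D ∩ {z | 0 ≤ z.2}) := by
    rw [← image_projP_norm_projQ_completion hp hD]
    exact hc.image _ (continuous_projP.prodMk continuous_projQ.norm).continuousOn
  rw [← hD.union_image_reflection]
  have hmem : (x, (0 : ℝ)) ∈ D ∩ {z | 0 ≤ z.2} := ⟨hx, le_refl (0 : ℝ)⟩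
  exact IsPreconnected.union (x, 0) hmem ⟨(x, 0), hmem, by simp⟩ hnonneg
    (hnonneg.image _ (reflection p).continuous.continuousOn)

theorem apply_seven_ne_zero (hw : w ∈ sphereQ 6) : w 7 ≠ 0 := fun h7 => by
  have hzero : w = 0 := by
    ext i
    rcases Nat.lt_or_ge 6 i.val with hi | hi
    · rw [show i = 7 from Fin.ext (by simp; omega), h7, PiLp.zero_apply]
    · exact hw.1 i hi
  simpa [hzero] using hw.2

theorem exists_mem_of_isConnected_completion_six {D : Set (Para 6)} (hD : IsReflInvariant D)
    (hc : IsConnected (completion 6 D)) : ∃ x, (x, (0 : ℝ)) ∈ D := by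
  obtain ⟨_, -, -, x, r, hr, hz, -⟩ := hc.nonempty
  have hη : EuclideanSpace.single 7 (1 : ℝ) ∈ sphereQ 6 := single_mem_sphereQ (by simp)
  have hcoord : ∀ w z, slicePt 6 w z 7 = z.2 * w 7 := fun w z => by simp [slicePt, incl]
  have hzero : (0 : ℝ) ∈ (fun y : Octonion => y 7) '' completion 6 D :=
    hc.isPreconnected.intermediate_value (slicePt_mem_completion hD hη (hD _ _ hz))
      (slicePt_mem_completion hD hη hz) (by fun_prop) (by simp [hcoord, hr])
  obtain ⟨_, ⟨w, hw, x', r', -, hz', rfl⟩, h0⟩ := hzero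
  have hr' : r' = 0 :=
    (mul_eq_zero.1 ((hcoord w _).symm.trans h0)).resolve_right (apply_seven_ne_zero hw)
  exact ⟨x', hr' ▸ hz'⟩

end Completion

section Main

variable {p : ℕ} {D : Set (Para p)} {w : Octonion} {z : Para p}

theorem sliceFun_eq {U : Set Octonion} (f : U → Octonion) (hz : slicePt p w z ∈ U) :
    sliceFun p f w z = f ⟨slicePt p w z, hz⟩ := by
  rw [sliceFun, dif_pos hz]

theorem sliceFun_congr {U : Set Octonion} (f : U → Octonion) {w' : Octonion} {z' : Para p}
    (h : slicePt p w z = slicePt p w' z') : sliceFun p f w z = sliceFun p f w' z' := by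
  unfold sliceFun
  congr! 3

theorem sliceFun_induced (hp : p ≤ 6) (hD : IsReflInvariant D) {F : Para p → Octonion × Octonion}
    (hF : IsStem D F) (hw : w ∈ sphereQ p) (hz : z ∈ D) :
    sliceFun p (induced p D F) w z = (F z).1 + w * (F z).2 := by
  obtain ⟨x, r⟩ := z
  rcases le_total 0 r with hr | hr
  · rw [sliceFun_eq _ (slicePt_mem_completion hD hw hz), induced_slicePt hp hF hw hr hz]
  · have hz' := hD _ _ hz
    have hw' := neg_mem_sphereQ hw
    rw [sliceFun_congr _ (slicePt_neg w x r).symm,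
      sliceFun_eq _ (slicePt_mem_completion hD hw' hz'),
      induced_slicePt hp hF hw' (neg_nonneg.2 hr) hz', (hF x r hz).1, (hF x r hz).2, neg_mul_neg]

theorem mem_GSM_completion_iff (hp : p ≤ 6) (hD : IsReflInvariant D)
    {f : completion p D → Octonion} :
    f ∈ GSM p (completion p D) ↔
      ∀ w ∈ sphereQ p, IsSliceMonogenicOn w (sliceFun p f w) D :=
  forall₂_congr fun w hw => by rw [sliceSet_completion hp hD hw]; rfl

theorem GSR_subset_GSM (hp : p ≤ 6) (hDo : IsOpen D) (hD : IsReflInvariant D) :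
    GSR p D ⊆ GSM p (completion p D) := by
  rintro f ⟨F, hF, hFc, hcr, rfl⟩
  exact (mem_GSM_completion_iff hp hD).2 fun w hw =>
    (isSliceMonogenicOn_add_mul hp hDo hw hFc.fst hFc.snd hcr).congr hDo fun z hz =>
      sliceFun_induced hp hD hF hw hz

theorem GSM_subset_GSR (hp : p ≤ 6) (hDo : IsOpen D) (hD : IsReflInvariant D)
    (hc : IsPreconnected (completion p D)) {x₀ : EuclideanSpace ℝ (Fin (p + 1))}
    (hx₀ : (x₀, (0 : ℝ)) ∈ D) : GSM p (completion p D) ⊆ GSR p D := by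
  intro f hf
  rw [mem_GSM_completion_iff hp hD] at hf
  let η : Octonion := EuclideanSpace.single 7 1
  have hη : η ∈ sphereQ p := single_mem_sphereQ (by simp; omega)
  let F := stemOf η (sliceFun p f η)
  have hF : ContDiffOn ℝ 1 F D := contDiffOn_stemOf hD η (hf η hη).1
  have hcr := fun z hz => (hf η hη).cauchyRiemann_stemOf hp hDo hD hη (z := z) hz
  have hrepr : ∀ w ∈ sphereQ p, EqOn (sliceFun p f w) (fun z => (F z).1 + w * (F z).2) D :=
    fun w hw => by
    refine (hf w hw).eqOn hp hw hDo (isPreconnected_of_completion hp hD hc hx₀)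
      (isSliceMonogenicOn_add_mul hp hDo hw hF.fst hF.snd hcr) (fun x _ => ?_) hx₀
    have hreal : sliceFun p f w (x, 0) = sliceFun p f η (x, 0) :=
      sliceFun_congr f (by rw [slicePt_zero, slicePt_zero])
    have hsnd : (F (x, 0)).2 = 0 := by simp [F, stemOf]
    rw [hreal, ← stemOf_fst_add_mul_snd hη (sliceFun p f η) (x, 0)]
    simp only [F] at hsnd ⊢
    rw [hsnd, mul_zero, mul_zero]
  refine ⟨F, isStem_stemOf _ _, hF, hcr, funext fun ⟨y, hy⟩ => ?_⟩
  obtain ⟨w, hw, x, r, hr, hz, rfl⟩ := id hy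
  rw [induced_slicePt hp (isStem_stemOf _ _) hw hr hz, ← sliceFun_eq f hy]
  exact hrepr w hw hz

open Classical in
/-- The indicator function of the open half-slice `{x_p + r v : r > 0}`. A point of `ℝ^{p+1}` is
not in it, since there the normalized component is `0`. -/
noncomputable def halfSliceIndicator (p : ℕ) (U : Set Octonion) (v : Octonion) : U → Octonion :=
  fun y => if ‖projQ p (y : Octonion)‖⁻¹ • projQ p (y : Octonion) = v then
    EuclideanSpace.single 0 1 else 0

open Classical in
theorem sliceFun_halfSliceIndicator_of_pos (hD : IsReflInvariant D) (v : Octonion)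
    (hw : w ∈ sphereQ p) (hz : z ∈ D) (hr : 0 < z.2) :
    sliceFun p (halfSliceIndicator p (completion p D) v) w z =
      if w = v then EuclideanSpace.single 0 1 else 0 := by
  rw [sliceFun_eq _ (slicePt_mem_completion hD hw hz), halfSliceIndicator,
    norm_projQ_slicePt hw, projQ_slicePt hw, abs_of_pos hr, inv_smul_smul₀ hr.ne']

open Classical in
theorem sliceFun_halfSliceIndicator_of_neg (hD : IsReflInvariant D) (v : Octonion)
    (hw : w ∈ sphereQ p) (hz : z ∈ D) (hr : z.2 < 0) :
    sliceFun p (halfSliceIndicator p (completion p D) v) w z =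
      if -w = v then EuclideanSpace.single 0 1 else 0 := by
  rw [sliceFun_congr _ (slicePt_neg w z.1 z.2).symm]
  exact sliceFun_halfSliceIndicator_of_pos hD v (neg_mem_sphereQ hw) (hD _ _ hz) (neg_pos.2 hr)

theorem eventually_sliceFun_halfSliceIndicator_eq (hDo : IsOpen D) (hD : IsReflInvariant D)
    (v : Octonion) (hw : w ∈ sphereQ p) (hz : z ∈ D) (hr : z.2 ≠ 0) :
    sliceFun p (halfSliceIndicator p (completion p D) v) w =ᶠ[𝓝 z]
      fun _ => sliceFun p (halfSliceIndicator p (completion p D) v) w z := by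
  rcases hr.lt_or_gt with hr | hr
  · filter_upwards [hDo.mem_nhds hz, continuous_snd.continuousAt.eventually_lt_const hr]
      with z' hz' hr'
    rw [sliceFun_halfSliceIndicator_of_neg hD v hw hz' hr',
      sliceFun_halfSliceIndicator_of_neg hD v hw hz hr]
  · filter_upwards [hDo.mem_nhds hz, continuous_snd.continuousAt.eventually_const_lt hr]
      with z' hz' hr'
    rw [sliceFun_halfSliceIndicator_of_pos hD v hw hz' hr',
      sliceFun_halfSliceIndicator_of_pos hD v hw hz hr]

theorem halfSliceIndicator_mem_GSM (hp : p ≤ 6) (hDo : IsOpen D) (hD : IsReflInvariant D)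
    (h0 : ∀ z ∈ D, z.2 ≠ 0) (v : Octonion) :
    halfSliceIndicator p (completion p D) v ∈ GSM p (completion p D) := by
  rw [mem_GSM_completion_iff hp hD]
  intro w hw
  have hlocal := fun z hz => eventually_sliceFun_halfSliceIndicator_eq hDo hD v hw hz (h0 z hz)
  exact ⟨fun z hz => (contDiffAt_const.congr_of_eventuallyEq (hlocal z hz)).contDiffWithinAt,
    fun z hz => by rw [sliceDirac_congr (hlocal z hz), sliceDirac_const]⟩

theorem halfSliceIndicator_notMem_GSR (hp : p ≤ 6) (hD : IsReflInvariant D) {u v : Octonion}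
    (hu : u ∈ sphereQ p) (hv : v ∈ sphereQ p) (huv : u ≠ v) (hnuv : -u ≠ v) (hz : z ∈ D)
    (hr : 0 < z.2) : halfSliceIndicator p (completion p D) v ∉ GSR p D := by
  rintro ⟨F, hF, -, -, hFv⟩
  have hval : ∀ w ∈ sphereQ p, (F z).1 + w * (F z).2 =
      sliceFun p (halfSliceIndicator p (completion p D) v) w z := fun w hw => by
    rw [hFv, sliceFun_induced hp hD hF hw hz]
  have hpos : (F z).1 + u * (F z).2 = 0 := by
    rw [hval u hu, sliceFun_halfSliceIndicator_of_pos hD v hu hz hr, if_neg huv]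
  have hneg : (F z).1 - u * (F z).2 = 0 := by
    rw [sub_eq_add_neg, ← neg_mul, hval _ (neg_mem_sphereQ hu),
      sliceFun_halfSliceIndicator_of_pos hD v (neg_mem_sphereQ hu) hz hr, if_neg hnuv]
  obtain ⟨hfst, hmul⟩ := eq_zero_of_add_eq_zero_of_sub_eq_zero hpos hneg
  have hv1 := hval v hv
  rw [hfst, eq_zero_of_sphereQ_mul_eq_zero hu hmul, mul_zero, add_zero,
    sliceFun_halfSliceIndicator_of_pos hD v hv hz hr, if_pos rfl] at hv1
  simpa using hv1.symm

end Main

end OctSlice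

theorem mainTheorem7 (p : ℕ) (hp : p ≤ 6) (D : Set (OctSlice.Para p))
    (hDopen : IsOpen D) (hDrefl : OctSlice.IsReflInvariant D)
    (hopen : IsOpen (OctSlice.completion p D))
    (hconn : IsConnected (OctSlice.completion p D))
    (hsymm : OctSlice.IsPSymmetric p (OctSlice.completion p D)) :
    (OctSlice.completion p D ∩ OctSlice.realPart p = ∅ →
      OctSlice.GSR p D ⊂ OctSlice.GSM p (OctSlice.completion p D)) ∧
    ((OctSlice.completion p D ∩ OctSlice.realPart p).Nonempty →
      OctSlice.GSM p (OctSlice.completion p D) = OctSlice.GSR p D) := by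
  have hreal := OctSlice.completion_inter_realPart_nonempty_iff hp hDrefl
  have hsub := OctSlice.GSR_subset_GSM hp hDopen hDrefl
  refine ⟨fun hempty => ?_, fun hne => ?_⟩
  · rw [← Set.not_nonempty_iff_eq_empty, hreal] at hempty
    have h0 : ∀ z ∈ D, z.2 ≠ 0 := fun z hz hr => hempty ⟨z.1, hr ▸ hz⟩
    have hp5 : p < 6 := hp.lt_of_ne fun h => by
      subst h
      exact hempty (OctSlice.exists_mem_of_isConnected_completion_six hDrefl hconn)
    obtain ⟨_, -, -, x, r, hr, hz, -⟩ := hconn.nonempty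
    exact Set.ssubset_iff_exists.2 ⟨hsub, _,
      OctSlice.halfSliceIndicator_mem_GSM hp hDopen hDrefl h0 _,
      OctSlice.halfSliceIndicator_notMem_GSR hp hDrefl
        (OctSlice.single_mem_sphereQ (i := 6) hp5)
        (OctSlice.single_mem_sphereQ (i := 7) (hp5.trans (by simp)))
        (fun h => by simpa using congrArg (fun y : OctSlice.Octonion => y 6) h)
        (fun h => by simpa using congrArg (fun y : OctSlice.Octonion => y 6) h) hz
        (hr.lt_of_ne (h0 _ hz).symm)⟩
  · obtain ⟨x, hx⟩ := hreal.1 hne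
    exact (OctSlice.GSM_subset_GSR hp hDopen hDrefl hconn.isPreconnected hx).antisymm hsub
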